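/- Let $S$ be a finite set of at least five points in the Euclidean plane in general position (no three points of $S$ are collinear), and let $s,t\in S$ be two (not necessarily distinct) points of $S$ that lie on the boundary of the convex hull of $S$. Then there are two paths $P$ and $Q$ in the complete graph with vertex set $S$, whose edges are drawn as straight-line segments, such that: $P$ starts at $s$ and $Q$ starts at $t$; each of $P$ and $Q$ visits every point of $S$ exactly once; each of $P$ and $Q$ is plane, i.e. two different edges of the same path meet at most in a common endpoint; and $P$ and $Q$ have no edge in common (edges of $P$ may cross edges of $Q$). Moreover, if $s\neq t$, then $P$ and $Q$ can be chosen so that neither of them contains the edge $st$. -/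

import Mathlib

/-- The Euclidean plane. -/
abbrev Plane : Type := EuclideanSpace ℝ (Fin 2)

/-- A set of points is in general position if no three distinct points of it are collinear. -/
def InGeneralPosition (S : Set Plane) : Prop :=
  ∀ a ∈ S, ∀ b ∈ S, ∀ c ∈ S, a ≠ b → a ≠ c → b ≠ c → ¬ Collinear ℝ {a, b, c}

/-- Walks in the complete graph on all points of the plane. An edge `s(a, b)` is drawn as the
straight-line segment `segment ℝ a b`. A path of the complete geometric graph on a point set `S`
is the same as a path in this graph all of whose vertices lie in `S`. -/
abbrev GeometricWalk (u v : Plane) : Type := (⊤ : SimpleGraph Plane).Walk u v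

/-- Crossing-free: the segments of two different edges meet at most in a common endpoint. -/
def IsCrossingFree {u v : Plane} (P : GeometricWalk u v) : Prop :=
  ∀ a b c d : Plane, s(a, b) ∈ P.edges → s(c, d) ∈ P.edges → s(a, b) ≠ s(c, d) →
    segment ℝ a b ∩ segment ℝ c d ⊆ ({a, b} : Set Plane) ∩ {c, d}

/-- `P` is a plane spanning path of `S`, starting at `u` and ending at `v`: no vertex is repeated,
the set of vertices is exactly `S`, and the drawing is crossing-free. -/
structure IsPlaneSpanningPath (S : Set Plane) {u v : Plane} (P : GeometricWalk u v) : Prop where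
  isPath : P.IsPath
  spanning : {x | x ∈ P.support} = S
  crossingFree : IsCrossingFree P

/-!
Two edge-disjoint plane spanning paths from vertices `s` and `t` of the convex hull of a planar set.

All geometry is expressed by the sign of `orient a b x`, and points on the boundary of the hull
enter as points outside the convex hull of the other points (`notMem_convexHull_of_mem_frontier`).
Paths are lists of points; two plane paths with disjoint hulls may be joined by a segment whose
ends see each other (`IsPlanePath.append`).

Suppose that a line separates the point set into halves `A` and `B`. A zigzag path, which always
goes on to the opposite end of the bridge of the points that remain, is plane and uses only edges
between `A` and `B` (`exists_zigzag`). A path that first visits all of `A` and then all of `B` has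
only one such edge. So the two are edge-disjoint as soon as that one edge avoids the zigzag.

For `s ≠ t` take a line through `t` that halves the other points, with `s` on the side `L`, and let
the second path zigzag from `t`. The first path visits `L` from `s`, comes to `t`, and then has two
tangents from `t` to `R` to choose from, only one of which may be in the zigzag
(`hasDisjointPaths_of_halving`). There is no such line exactly if the line through `s` and `t`
itself halves the set. Then the first path is sent from `s` through `L` to the point `c` of `L` next
to `t`, and on to `t`; this fails only if `c` is the first point of the zigzag after `t`
(`DiagonalSplit.hasDisjointPaths_of_ne`). If it fails on both sides of the line, then the ends `b`,
`q` of the bridge of `L` and `R` are so placed that a zigzag can start with `t`, `b`, `q`, and the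
first path can cross from `b` by the tangent to `R` (`DiagonalSplit.hasDisjointPaths_of_eq`).

For `s = t` remove `s` and start from two points of contact of the tangents from `s`; only the case
of five points has to be treated separately.
-/

section

open scoped Classical

/-! ### Orientation of triples and general position -/

/-- Twice the signed area of the triangle `a b x`, as an affine function of `x`. It is positive
exactly when `x` lies to the left of the directed line from `a` to `b`. -/
noncomputable def orient (a b : Plane) : Plane →ᵃ[ℝ] ℝ :=
  ((b 0 - a 0) • (EuclideanSpace.proj 1 : Plane →L[ℝ] ℝ).toLinearMap -
    (b 1 - a 1) • (EuclideanSpace.proj 0 : Plane →L[ℝ] ℝ).toLinearMap).toAffineMap +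
  AffineMap.const ℝ Plane ((b 1 - a 1) * a 0 - (b 0 - a 0) * a 1)

theorem orient_apply (a b x : Plane) :
    orient a b x = (b 0 - a 0) * (x 1 - a 1) - (b 1 - a 1) * (x 0 - a 0) := by
  simp [orient]
  ring

theorem orient_self_left (a b : Plane) : orient a b a = 0 := by
  simp [orient_apply]

theorem orient_self_right (a b : Plane) : orient a b b = 0 := by
  simp [orient_apply]; ring

theorem orient_swap (a b x : Plane) : orient b a x = -orient a b x := by
  simp only [orient_apply]; ring

theorem orient_rotate (a b x : Plane) : orient b x a = orient a b x := by
  simp only [orient_apply]; ring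

theorem orient_swap_right (a b x : Plane) : orient a x b = -orient a b x := by
  simp only [orient_apply]; ring

/-- Every affine function on the plane has the usual coordinate form. -/
theorem affineMap_eq_coords (φ : Plane →ᵃ[ℝ] ℝ) :
    ∃ α β γ : ℝ, ∀ x, φ x = α * x 0 + β * x 1 + γ := by
  refine ⟨φ.linear (EuclideanSpace.single 0 1), φ.linear (EuclideanSpace.single 1 1), φ 0,
    fun x => ?_⟩
  have h1 : φ x = φ.linear x + φ 0 := congrFun φ.decomp x
  have h2 : x = x 0 • EuclideanSpace.single 0 (1 : ℝ) + x 1 • EuclideanSpace.single 1 (1 : ℝ) := by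
    ext i; fin_cases i <;> simp
  rw [h1]
  conv_lhs => rw [h2]
  simp [mul_comm]

theorem collinear_of_orient_eq_zero {a b c : Plane} (hab : a ≠ b) (h : orient a b c = 0) :
    Collinear ℝ ({a, b, c} : Set Plane) := by
  rw [orient_apply] at h
  rw [collinear_iff_of_mem (p₀ := a) (by simp)]
  refine ⟨b - a, ?_⟩
  have key : ∃ r : ℝ, c = r • (b - a) + a := by
    by_cases h0 : b 0 = a 0
    · have h1 : b 1 - a 1 ≠ 0 := by
        intro h1
        apply hab
        ext i; fin_cases i
        · exact h0.symm
        · simpa using (sub_eq_zero.1 h1).symm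
      refine ⟨(c 1 - a 1) / (b 1 - a 1), ?_⟩
      ext i; fin_cases i
      · simp [h0]
        simp [h0, h1] at h
        linarith
      · simp; field_simp; ring
    · have h1 : b 0 - a 0 ≠ 0 := sub_ne_zero.2 h0
      refine ⟨(c 0 - a 0) / (b 0 - a 0), ?_⟩
      ext i; fin_cases i
      · simp; field_simp; ring
      · simp; field_simp; linarith
  rintro p (rfl | rfl | rfl)
  · exact ⟨0, by simp⟩
  · exact ⟨1, by simp⟩
  · exact key

theorem InGeneralPosition.mono {X Y : Set Plane} (hY : InGeneralPosition Y) (h : X ⊆ Y) :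
    InGeneralPosition X :=
  fun a ha b hb c hc => hY a (h ha) b (h hb) c (h hc)

theorem InGeneralPosition.orient_ne_zero {X : Set Plane} (hX : InGeneralPosition X) {a b c : Plane}
    (ha : a ∈ X) (hb : b ∈ X) (hc : c ∈ X) (hab : a ≠ b) (hac : a ≠ c) (hbc : b ≠ c) :
    orient a b c ≠ 0 :=
  fun h => hX a ha b hb c hc hab hac hbc (collinear_of_orient_eq_zero hab h)

theorem InGeneralPosition.eq_or_eq_of_mem_segment {X : Set Plane} (hX : InGeneralPosition X)
    {a b x : Plane} (ha : a ∈ X) (hb : b ∈ X) (hx : x ∈ X) (h : x ∈ segment ℝ a b) :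
    x = a ∨ x = b := by
  by_contra! hne
  rcases eq_or_ne a b with rfl | hab
  · simp [segment_same] at h
    exact hne.1 h
  · exact hX a ha x hx b hb hne.1.symm hab hne.2 (mem_segment_iff_wbtw.1 h).collinear

/-! ### Convex hulls, extreme points and visibility -/

/-- A point on the zero line of an affine function which is positive on the other points is not
in their convex hull. -/
theorem notMem_convexHull_of_pos {X : Set Plane} {a : Plane} (φ : Plane →ᵃ[ℝ] ℝ) (ha : φ a ≤ 0)
    (hX : ∀ x ∈ X, 0 < φ x) : a ∉ convexHull ℝ X := by
  intro h
  have : convexHull ℝ X ⊆ φ ⁻¹' Set.Ioi 0 :=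
    convexHull_min hX ((convex_Ioi 0).affine_preimage φ)
  exact absurd (this h) (by simpa using ha)

theorem nonneg_of_mem_convexHull {X : Set Plane} (φ : Plane →ᵃ[ℝ] ℝ) (hX : ∀ x ∈ X, 0 ≤ φ x)
    {x : Plane} (hx : x ∈ convexHull ℝ X) : 0 ≤ φ x :=
  (convexHull_min hX ((convex_Ici 0).affine_preimage φ) : convexHull ℝ X ⊆ φ ⁻¹' Set.Ici 0) hx

/-- If `φ` vanishes at `p` and is positive on the rest of `X`, then `p` is the only zero of `φ`
on the convex hull of `X`. -/
theorem eq_of_mem_convexHull {X : Set Plane} {p : Plane} (φ : Plane →ᵃ[ℝ] ℝ) (hp : φ p = 0)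
    (hX : ∀ x ∈ X, x ≠ p → 0 < φ x) {x : Plane} (hx : x ∈ convexHull ℝ X) (h0 : φ x ≤ 0) :
    x = p := by
  have hconv : Convex ℝ {y : Plane | 0 < φ y ∨ y = p} := by
    rw [convex_iff_forall_pos]
    rintro y hy z hz a b ha hb hab
    by_cases h : y = p ∧ z = p
    · right; rw [h.1, h.2, ← add_smul, hab, one_smul]
    · left
      have hy0 : 0 ≤ φ y := hy.elim le_of_lt (fun h => by rw [h, hp])
      have hz0 : 0 ≤ φ z := hz.elim le_of_lt (fun h => by rw [h, hp])
      rw [Convex.combo_affine_apply hab, smul_eq_mul, smul_eq_mul]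
      rcases not_and_or.1 h with h | h
      · have := mul_pos ha (hy.resolve_right h)
        have := mul_nonneg hb.le hz0
        linarith
      · have := mul_pos hb (hz.resolve_right h)
        have := mul_nonneg ha.le hy0
        linarith
  have hsub : convexHull ℝ X ⊆ {y : Plane | 0 < φ y ∨ y = p} :=
    convexHull_min (fun y hy => by
      by_cases h : y = p
      · exact Or.inr h
      · exact Or.inl (hX y hy h)) hconv
  rcases hsub hx with h | h
  · exact absurd h0 (not_le.2 h)
  · exact h

/-- A point outside the hull of a finite set can be separated from it by a line through the
point. -/
theorem exists_pos_of_notMem_convexHull {X : Set Plane} (hX : X.Finite) {a : Plane}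
    (ha : a ∉ convexHull ℝ X) : ∃ φ : Plane →ᵃ[ℝ] ℝ, φ a = 0 ∧ ∀ x ∈ X, 0 < φ x := by
  obtain ⟨f, u, h1, h2⟩ := geometric_hahn_banach_point_closed (convex_convexHull ℝ X)
    (hX.isClosed_convexHull ℝ) ha
  refine ⟨f.toLinearMap.toAffineMap - AffineMap.const ℝ Plane (f a), by simp, fun x hx => ?_⟩
  have := h2 x (subset_convexHull ℝ X hx)
  simp
  linarith

/-- `a` sees the point `b` of the set `X`: the segment from `a` to `b` meets the convex hull of
`X` at most in `b`. -/
def Sees (a b : Plane) (X : Set Plane) : Prop :=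
  ∀ x ∈ segment ℝ a b, x ∈ convexHull ℝ X → x = b

/-- A line through `b` with `a` strictly on one side and `X` on the other makes `b` visible. -/
theorem sees_of_neg {a b : Plane} {X : Set Plane} (φ : Plane →ᵃ[ℝ] ℝ) (ha : φ a < 0)
    (hb : φ b = 0) (hX : ∀ x ∈ X, 0 ≤ φ x) : Sees a b X := by
  rintro x ⟨u, v, hu, hv, huv, rfl⟩ hx
  have h := nonneg_of_mem_convexHull φ hX hx
  rw [Convex.combo_affine_apply huv, hb, smul_eq_mul, smul_zero, add_zero] at h
  have hu0 : u = 0 := by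
    by_contra hne
    exact absurd h (not_le.2 (mul_neg_of_pos_of_neg (lt_of_le_of_ne hu (Ne.symm hne)) ha))
  have hv1 : v = 1 := by linarith
  simp [hu0, hv1]

/-- The points of contact of the tangents from `a` are visible. -/
theorem sees_of_tangent {a b : Plane} {X : Set Plane} (φ : Plane →ᵃ[ℝ] ℝ) (ha : φ a = 0)
    (hb : φ b = 0) (hX : ∀ x ∈ X, x ≠ b → 0 < φ x) : Sees a b X := by
  rintro x ⟨u, v, hu, hv, huv, rfl⟩ hx
  refine eq_of_mem_convexHull φ hb hX hx ?_
  rw [Convex.combo_affine_apply huv, ha, hb]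
  simp

theorem sees_singleton (a b : Plane) : Sees a b {b} := by
  intro x _ hx
  simpa using hx

/-- A point on the boundary of the convex hull of a set in general position is a vertex of the
hull: otherwise it is, by Carathéodory, in the interior of a triangle of points of the set. -/
theorem notMem_convexHull_of_mem_frontier {S : Set Plane} (hS : InGeneralPosition S) {s : Plane}
    (hs : s ∈ S) (hf : s ∈ frontier (convexHull ℝ S)) : s ∉ convexHull ℝ (S \ {s}) := by
  intro h
  obtain ⟨ι, _, z, w, hz, hind, hw, hw1, hws⟩ := eq_pos_convex_span_of_mem_convexHull h
  have hzS : ∀ i, z i ∈ S ∧ z i ≠ s := fun i => by simpa using hz ⟨i, rfl⟩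
  have hfr : Module.finrank ℝ Plane = 2 := by simp
  rcases lt_or_ge (Fintype.card ι) 3 with hlt | hge
  · have h12 : Fintype.card ι = 0 ∨ Fintype.card ι = 1 ∨ Fintype.card ι = 2 := by omega
    rcases h12 with h0 | h0 | h0
    · have := Fintype.card_eq_zero_iff.1 h0
      simp at hw1
    · obtain ⟨i, hi⟩ := Fintype.card_eq_one_iff.1 h0
      have hu : (Finset.univ : Finset ι) = {i} := by ext j; simp [hi j]
      rw [hu, Finset.sum_singleton] at hw1 hws
      rw [hw1, one_smul] at hws
      exact (hzS i).2 hws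
    · obtain ⟨e⟩ := (⟨Fintype.equivFinOfCardEq h0⟩ : Nonempty (ι ≃ Fin 2))
      rw [← e.symm.sum_comp, Fin.sum_univ_two] at hw1 hws
      have hmem : s ∈ segment ℝ (z (e.symm 0)) (z (e.symm 1)) :=
        ⟨_, _, (hw _).le, (hw _).le, hw1, hws⟩
      rcases hS.eq_or_eq_of_mem_segment (hzS _).1 (hzS _).1 hs hmem with h | h
      · exact (hzS _).2 h.symm
      · exact (hzS _).2 h.symm
  · have hcard : Fintype.card ι = Module.finrank ℝ Plane + 1 := by
      have h1 := hind.card_le_finrank_succ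
      have h2 := Submodule.finrank_le (vectorSpan ℝ (Set.range z))
      omega
    let b : AffineBasis ι ℝ Plane :=
      ⟨z, hind, hind.affineSpan_eq_top_iff_card_eq_finrank_add_one.2 hcard⟩
    have hsi : s ∈ interior (convexHull ℝ (Set.range b)) := by
      rw [b.interior_convexHull]
      intro i
      have : s = Finset.univ.affineCombination ℝ b w := by
        rw [Finset.affineCombination_eq_linear_combination _ _ _ hw1]
        exact hws.symm
      rw [this, b.coord_apply_combination_of_mem (Finset.mem_univ i) hw1]
      exact hw i
    exact hf.2 (interior_mono (convexHull_mono (fun y hy => (hz hy).1)) hsi)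

theorem notMem_convexHull_mono {X Y : Set Plane} {a : Plane} (h : a ∉ convexHull ℝ Y)
    (hXY : X ⊆ Y) : a ∉ convexHull ℝ X := fun ha => h (convexHull_mono hXY ha)

/-! ### Tangents, diagonals and bridges -/

/-- Seen from a point `q` outside the convex hull of `X`, some point `p` of `X` is the last one in
the radial order. The order is that of the slopes with respect to a line through `q` that has `X`
on one side. -/
theorem exists_tangent {X : Finset Plane} {q : Plane} (hX : X.Nonempty)
    (hq : q ∉ convexHull ℝ (X : Set Plane)) (hgen : InGeneralPosition (insert q (X : Set Plane)))
    {σ : ℝ} (hσ : σ ≠ 0) : ∃ p ∈ X, ∀ x ∈ X, x ≠ p → 0 < σ * orient q p x := by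
  obtain ⟨φ, hφq, hφ⟩ := exists_pos_of_notMem_convexHull X.finite_toSet hq
  obtain ⟨α, β, γ, hc⟩ := affineMap_eq_coords φ
  let r : Plane → ℝ := fun x => σ * (α * (x 1 - q 1) - β * (x 0 - q 0)) / φ x
  obtain ⟨p, hp, hmin⟩ := X.exists_min_image r hX
  refine ⟨p, hp, fun x hx hxp => ?_⟩
  have hpp := hφ p hp
  have hxx := hφ x hx
  have hqp : q ≠ p := by rintro rfl; simp [hφq] at hpp
  have hqx : q ≠ x := by rintro rfl; simp [hφq] at hxx
  have hne : σ * orient q p x ≠ 0 := mul_ne_zero hσ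
    (hgen.orient_ne_zero (by simp) (by simp [hp]) (by simp [hx]) hqp hqx hxp.symm)
  have hle := hmin x hx
  rw [div_le_div_iff₀ hpp hxx] at hle
  -- the cross product of the two slopes is a positive multiple of the orientation
  have hid : (α ^ 2 + β ^ 2) * (σ * orient q p x) =
      σ * (α * (x 1 - q 1) - β * (x 0 - q 0)) * φ p -
        σ * (α * (p 1 - q 1) - β * (p 0 - q 0)) * φ x := by
    have hq0 : γ = -(α * q 0 + β * q 1) := by have := hc q; rw [hφq] at this; linarith
    rw [hc p, hc x, orient_apply, hq0]
    ring
  have hN : 0 < α ^ 2 + β ^ 2 := by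
    rcases eq_or_ne α 0 with h | h
    · rcases eq_or_ne β 0 with h' | h'
      · rw [hc p] at hpp
        rw [hc q] at hφq
        simp [h, h'] at hpp hφq
        linarith
      · positivity
    · positivity
  have h0 : 0 ≤ (α ^ 2 + β ^ 2) * (σ * orient q p x) := by rw [hid]; linarith
  exact lt_of_le_of_ne (nonneg_of_mul_nonneg_right h0 hN) hne.symm

theorem sees_of_forall_orient_pos {X : Set Plane} {q p : Plane} {σ : ℝ}
    (h : ∀ x ∈ X, x ≠ p → 0 < σ * orient q p x) : Sees q p X :=
  sees_of_tangent (σ • orient q p) (by simp [orient_self_left]) (by simp [orient_self_right])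
    (by simpa using h)

/-- A point beyond a bridge sees the ends of the bridge. -/
theorem sees_of_bridge {X : Set Plane} {a b q : Plane} {σ : ℝ} (hq : 0 < σ * orient a b q)
    (h : ∀ x ∈ X, x ≠ a → x ≠ b → σ * orient a b x < 0) : Sees q b X := by
  refine sees_of_neg ((-σ) • orient a b) (by simpa using hq) (by simp [orient_self_right]) ?_
  intro x hx
  by_cases h1 : x = a
  · simp [h1, orient_self_left]
  by_cases h2 : x = b
  · simp [h2, orient_self_right]
  · have := h x hx h1 h2
    simp
    linarith

theorem notMem_convexHull_of_forall_orient_pos {X : Set Plane} {q p : Plane} {σ : ℝ}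
    (h : ∀ x ∈ X, x ≠ p → 0 < σ * orient q p x) : p ∉ convexHull ℝ (X \ {p}) :=
  notMem_convexHull_of_pos (σ • orient q p) (by simp [orient_self_right])
    (fun x hx => by simpa using h x hx.1 hx.2)

/-- If a vertex `t` of the convex hull sees `a` and `b` on different sides of `u`, then it sees
`a` before `b`. -/
theorem orient_pos_of_diagonal {X : Set Plane} (hX : X.Finite) {t u a b : Plane}
    (ht : t ∉ convexHull ℝ X) (hu : u ∈ X) (ha : a ∈ X) (hb : b ∈ X) {σ : ℝ}
    (h1 : σ * orient t u a < 0) (h2 : 0 < σ * orient t u b) : 0 < σ * orient t a b := by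
  obtain ⟨φ, hφt, hφ⟩ := exists_pos_of_notMem_convexHull hX ht
  obtain ⟨α, β, γ, hc⟩ := affineMap_eq_coords φ
  have hid : orient t u a * φ b - orient t u b * φ a + orient t a b * φ u = 0 := by
    have hq0 : γ = -(α * t 0 + β * t 1) := by have := hc t; rw [hφt] at this; linarith
    rw [hc u, hc a, hc b, hq0]
    simp only [orient_apply]
    ring
  have hau := mul_neg_of_neg_of_pos h1 (hφ b hb)
  have hbu := mul_pos h2 (hφ a ha)
  have : 0 < σ * orient t a b * φ u := by
    have hid' := congrArg (σ * ·) hid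
    simp only [mul_zero] at hid'
    linarith
  exact pos_of_mul_pos_left this (hφ u hu).le

/-- Two nonempty sets separated by a line have a bridge: a segment between them such that all
the other points lie on the same side of it; the sign of `σ` prescribes the side. It is a segment
whose intersection with the separating line is extremal. -/
theorem exists_bridge {A B : Finset Plane} (hA : A.Nonempty) (hB : B.Nonempty)
    (hgen : InGeneralPosition (A ∪ B : Set Plane)) (φ : Plane →ᵃ[ℝ] ℝ) (hφA : ∀ a ∈ A, φ a < 0)
    (hφB : ∀ b ∈ B, 0 < φ b) {σ : ℝ} (hσ : σ ≠ 0) :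
    ∃ a ∈ A, ∃ b ∈ B, ∀ x ∈ (A ∪ B : Set Plane), x ≠ a → x ≠ b → σ * orient a b x < 0 := by
  obtain ⟨α, β, γ, hc⟩ := affineMap_eq_coords φ
  let ψ : Plane → ℝ := fun x => σ * (α * x 1 - β * x 0)
  let h : Plane × Plane → ℝ := fun p => (φ p.2 * ψ p.1 - φ p.1 * ψ p.2) / (φ p.2 - φ p.1)
  obtain ⟨⟨a, b⟩, hab, hmax⟩ := (A ×ˢ B).exists_max_image h (hA.product hB)
  obtain ⟨ha, hb⟩ := Finset.mem_product.1 hab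
  simp only at ha hb
  have hN : 0 < α ^ 2 + β ^ 2 := by
    have h1 := hφA a ha
    have h2 := hφB b hb
    rw [hc] at h1 h2
    rcases eq_or_ne α 0 with h | h
    · rcases eq_or_ne β 0 with h' | h'
      · simp [h, h'] at h1 h2; linarith
      · positivity
    · positivity
  have hφa := hφA a ha
  have hφb := hφB b hb
  have hne : a ≠ b := by rintro rfl; linarith
  refine ⟨a, ha, b, hb, fun x hx hxa hxb => ?_⟩
  have hx0 : σ * orient a b x ≠ 0 := mul_ne_zero hσ (hgen.orient_ne_zero (Or.inl ha)
    (Or.inr hb) hx hne hxa.symm hxb.symm)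
  have hle : (α ^ 2 + β ^ 2) * (σ * orient a b x) ≤ 0 := by
    have hid : (α ^ 2 + β ^ 2) * (σ * orient a b x) =
        (φ b - φ a) * (ψ x - ψ a) - (ψ b - ψ a) * (φ x - φ a) := by
      simp only [ψ, hc, orient_apply]; ring
    rcases hx with hx | hx
    · have hφx := hφA x hx
      have hm := hmax (x, b) (Finset.mem_product.2 ⟨hx, hb⟩)
      simp only [h] at hm
      rw [div_le_div_iff₀ (by linarith) (by linarith)] at hm
      have : φ b * ((φ b - φ a) * (ψ x - ψ a) - (ψ b - ψ a) * (φ x - φ a)) ≤ 0 := by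
        linear_combination hm
      rw [hid]
      exact nonpos_of_mul_nonpos_right this hφb
    · have hφx := hφB x hx
      have hm := hmax (a, x) (Finset.mem_product.2 ⟨ha, hx⟩)
      simp only [h] at hm
      rw [div_le_div_iff₀ (by linarith) (by linarith)] at hm
      have : (-φ a) * ((φ b - φ a) * (ψ x - ψ a) - (ψ b - ψ a) * (φ x - φ a)) ≤ 0 := by
        linear_combination hm
      rw [hid]
      exact nonpos_of_mul_nonpos_right this (by linarith)
  exact lt_of_le_of_ne (nonpos_of_mul_nonpos_right hle hN) hx0

/-- When an end `q` of the bridge `q b` of two separated sets is removed, `q` lies beyond every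
bridge `a' b'` of the remaining points. -/
theorem orient_pos_of_bridges {q b a' b' : Plane} (φ : Plane →ᵃ[ℝ] ℝ) {σ : ℝ}
    (hq : φ q < 0) (hb : 0 < φ b) (ha' : φ a' < 0) (hb' : 0 < φ b') (hqa : a' ≠ q)
    (h1 : ∀ x ∈ ({a', b'} : Set Plane), x ≠ q → x ≠ b → σ * orient q b x < 0)
    (h2 : b ≠ b' → σ * orient a' b' b < 0) (h0 : σ * orient a' b' q ≠ 0) :
    0 < σ * orient a' b' q := by
  have hab : a' ≠ b := by rintro rfl; linarith
  have hqb : b' ≠ q := by rintro rfl; linarith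
  have h3 := h1 a' (by simp) hqa hab
  rcases eq_or_ne b b' with rfl | hbb
  · have : orient a' b q = -orient q b a' := by simp only [orient_apply]; ring
    rw [this]; linarith
  · have h4 := h1 b' (by simp) hqb hbb.symm
    have h5 := h2 hbb
    by_contra hcon
    have h6 : σ * orient a' b' q < 0 := lt_of_le_of_ne (not_lt.1 hcon) h0
    obtain ⟨α, β, γ, hc⟩ := affineMap_eq_coords φ
    -- the affine dependence of the four points
    have hid : orient a' b' b * φ q - orient a' b' q * φ b + orient q b b' * φ a' -
        orient q b a' * φ b' = 0 := by
      simp only [hc, orient_apply]; ring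
    have e1 := mul_pos_of_neg_of_neg h5 hq
    have e2 := mul_neg_of_neg_of_pos h6 hb
    have e3 := mul_pos_of_neg_of_neg h4 ha'
    have e4 := mul_neg_of_neg_of_pos h3 hb'
    have hid' := congrArg (σ * ·) hid
    simp only [mul_zero] at hid'
    linarith

/-! ### Plane spanning paths as lists of points -/

/-- The edges of the polygonal path through the points of a list. -/
def pathEdges : List Plane → List (Sym2 Plane)
  | [] => []
  | [_] => []
  | a :: b :: l => s(a, b) :: pathEdges (b :: l)

/-- The points of `l`, in this order, form a crossing-free spanning path of `X`. -/
structure IsPlanePath (X : Set Plane) (l : List Plane) : Prop where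
  nodup : l.Nodup
  mem_iff : ∀ x, x ∈ l ↔ x ∈ X
  crossingFree : ∀ a b c d : Plane, s(a, b) ∈ pathEdges l → s(c, d) ∈ pathEdges l →
    s(a, b) ≠ s(c, d) → segment ℝ a b ∩ segment ℝ c d ⊆ ({a, b} : Set Plane) ∩ {c, d}

theorem mem_of_mem_pathEdges {a b : Plane} :
    ∀ {l : List Plane}, s(a, b) ∈ pathEdges l → a ∈ l ∧ b ∈ l
  | [], h => by simp [pathEdges] at h
  | [_], h => by simp [pathEdges] at h
  | x :: y :: l, h => by
    rw [pathEdges, List.mem_cons] at h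
    rcases h with h | h
    · rcases Sym2.eq_iff.1 h with ⟨rfl, rfl⟩ | ⟨rfl, rfl⟩ <;> simp
    · have := mem_of_mem_pathEdges h
      exact ⟨List.mem_cons_of_mem _ this.1, List.mem_cons_of_mem _ this.2⟩

theorem pathEdges_append (a b : Plane) (l' : List Plane) :
    ∀ l : List Plane, pathEdges (l ++ [a] ++ b :: l') =
      pathEdges (l ++ [a]) ++ s(a, b) :: pathEdges (b :: l')
  | [] => by simp [pathEdges]
  | [x] => by simp [pathEdges]
  | x :: y :: l => by
    have := pathEdges_append a b l' (y :: l)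
    simp only [List.cons_append] at this ⊢
    rw [pathEdges, this, pathEdges, List.cons_append]

/-- The first point of a path has only one incident edge. -/
theorem eq_of_mem_pathEdges_cons {a b x : Plane} {l : List Plane} (hl : (a :: b :: l).Nodup)
    (h : s(a, x) ∈ pathEdges (a :: b :: l)) : x = b := by
  rw [pathEdges, List.mem_cons] at h
  rcases h with h | h
  · rcases Sym2.eq_iff.1 h with ⟨_, h⟩ | ⟨h1, h2⟩
    · exact h
    · rw [h2, h1]
  · exact absurd (mem_of_mem_pathEdges h).1 (List.nodup_cons.1 hl).1

theorem exists_walk_of_nodup :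
    ∀ (l : List Plane) (a : Plane), (a :: l).Nodup →
      ∃ (v : Plane) (P : GeometricWalk a v), P.support = a :: l ∧ P.edges = pathEdges (a :: l)
  | [], a, _ => ⟨a, .nil, by simp, by simp [pathEdges]⟩
  | b :: l, a, h => by
    obtain ⟨v, P, h1, h2⟩ := exists_walk_of_nodup l b (List.nodup_cons.1 h).2
    have hab : a ≠ b := fun hab => (List.nodup_cons.1 h).1 (by simp [hab])
    refine ⟨v, .cons (by simpa using hab) P, by simp [h1], by simp [h2, pathEdges]⟩

theorem IsPlanePath.exists_walk {X : Set Plane} {a : Plane} {l : List Plane}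
    (h : IsPlanePath X (a :: l)) :
    ∃ (v : Plane) (P : GeometricWalk a v),
      IsPlaneSpanningPath X P ∧ P.edges = pathEdges (a :: l) := by
  obtain ⟨v, P, h1, h2⟩ := exists_walk_of_nodup l a h.nodup
  refine ⟨v, P, ⟨?_, ?_, ?_⟩, h2⟩
  · rw [SimpleGraph.Walk.isPath_def, h1]; exact h.nodup
  · ext x; rw [Set.mem_ofPred_eq, h1, h.mem_iff]
  · intro a b c d; rw [h2]; exact h.crossingFree a b c d

theorem isPlanePath_singleton (a : Plane) : IsPlanePath {a} [a] :=
  ⟨by simp, by simp, by simp [pathEdges]⟩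

theorem IsPlanePath.edge_mem {X : Set Plane} {l : List Plane} (h : IsPlanePath X l) {a b : Plane}
    (hab : s(a, b) ∈ pathEdges l) : a ∈ X ∧ b ∈ X :=
  ⟨(h.mem_iff a).1 (mem_of_mem_pathEdges hab).1, (h.mem_iff b).1 (mem_of_mem_pathEdges hab).2⟩

theorem IsPlanePath.segment_subset {X : Set Plane} {l : List Plane} (h : IsPlanePath X l)
    {a b : Plane} (hab : s(a, b) ∈ pathEdges l) : segment ℝ a b ⊆ convexHull ℝ X :=
  segment_subset_convexHull (h.edge_mem hab).1 (h.edge_mem hab).2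

/-- Two plane paths with disjoint convex hulls can be joined by a segment between ends that see
each other. -/
theorem IsPlanePath.append {X Y : Set Plane} {a b : Plane} {l l' : List Plane}
    (hX : IsPlanePath X (l ++ [a])) (hY : IsPlanePath Y (b :: l'))
    (hgen : InGeneralPosition (X ∪ Y)) (hdisj : Disjoint (convexHull ℝ X) (convexHull ℝ Y))
    (hab : Sees a b Y) (hba : Sees b a X) : IsPlanePath (X ∪ Y) (l ++ [a] ++ b :: l') := by
  have haX : a ∈ X := (hX.mem_iff a).1 (by simp)
  have hbY : b ∈ Y := (hY.mem_iff b).1 (by simp)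
  have hXY : ∀ x ∈ X, x ∉ Y := fun x h1 h2 => Set.disjoint_left.1 hdisj
    (subset_convexHull ℝ X h1) (subset_convexHull ℝ Y h2)
  -- an edge of either path meets the joining segment at most in a common end
  have hXs : ∀ c d x, s(c, d) ∈ pathEdges (l ++ [a]) → x ∈ segment ℝ c d → x ∈ segment ℝ a b →
      (x = c ∨ x = d) ∧ x = a := by
    intro c d x hcd hx hx'
    have hxa : x = a := hba x (segment_symm ℝ a b ▸ hx') (hX.segment_subset hcd hx)
    subst hxa
    exact ⟨hgen.eq_or_eq_of_mem_segment (Or.inl (hX.edge_mem hcd).1)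
      (Or.inl (hX.edge_mem hcd).2) (Or.inl haX) hx, rfl⟩
  have hYs : ∀ c d x, s(c, d) ∈ pathEdges (b :: l') → x ∈ segment ℝ c d → x ∈ segment ℝ a b →
      (x = c ∨ x = d) ∧ x = b := by
    intro c d x hcd hx hx'
    have hxb : x = b := hab x hx' (hY.segment_subset hcd hx)
    subst hxb
    exact ⟨hgen.eq_or_eq_of_mem_segment (Or.inr (hY.edge_mem hcd).1)
      (Or.inr (hY.edge_mem hcd).2) (Or.inr hbY) hx, rfl⟩
  have hseg : ∀ {c d : Plane}, s(c, d) = s(a, b) → segment ℝ c d = segment ℝ a b := by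
    intro c d h
    rcases Sym2.eq_iff.1 h with ⟨rfl, rfl⟩ | ⟨rfl, rfl⟩
    · rfl
    · exact segment_symm ℝ _ _
  have hpair : ∀ {c d x : Plane}, s(c, d) = s(a, b) → x = a ∨ x = b → x = c ∨ x = d := by
    intro c d x h hx
    rcases Sym2.eq_iff.1 h with ⟨rfl, rfl⟩ | ⟨rfl, rfl⟩
    · exact hx
    · exact hx.symm
  refine ⟨?_, ?_, ?_⟩
  · rw [List.nodup_append]
    refine ⟨hX.nodup, hY.nodup, fun x hx y hy hxy => ?_⟩
    subst hxy
    exact hXY x ((hX.mem_iff x).1 hx) ((hY.mem_iff x).1 hy)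
  · intro x
    rw [List.mem_append, hX.mem_iff, hY.mem_iff, Set.mem_union]
  · intro c d e f hcd hef hne x hx
    rw [pathEdges_append, List.mem_append, List.mem_cons] at hcd hef
    simp only [Set.mem_inter_iff, Set.mem_insert_iff, Set.mem_singleton_iff]
    rcases hcd with hcd | hcd | hcd <;> rcases hef with hef | hef | hef
    · simpa using hX.crossingFree c d e f hcd hef hne hx
    · have := hXs c d x hcd hx.1 (hseg hef ▸ hx.2)
      exact ⟨this.1, hpair hef (Or.inl this.2)⟩
    · exact absurd (hY.segment_subset hef hx.2)
        (Set.disjoint_left.1 hdisj (hX.segment_subset hcd hx.1))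
    · have := hXs e f x hef hx.2 (hseg hcd ▸ hx.1)
      exact ⟨hpair hcd (Or.inl this.2), this.1⟩
    · exact absurd (hcd.trans hef.symm) hne
    · have := hYs e f x hef hx.2 (hseg hcd ▸ hx.1)
      exact ⟨hpair hcd (Or.inr this.2), this.1⟩
    · exact absurd (hY.segment_subset hcd hx.1)
        (Set.disjoint_left.1 hdisj (hX.segment_subset hef hx.2))
    · have := hYs c d x hcd hx.1 (hseg hef ▸ hx.2)
      exact ⟨this.1, hpair hef (Or.inr this.2)⟩
    · simpa using hY.crossingFree c d e f hcd hef hne hx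

theorem IsPlanePath.cons {Y : Set Plane} {a b : Plane} {l : List Plane}
    (hY : IsPlanePath Y (b :: l)) (hgen : InGeneralPosition (insert a Y)) (haY : a ∉ Y)
    (hab : Sees a b Y) : IsPlanePath (insert a Y) (a :: b :: l) := by
  have hbY : b ∈ Y := (hY.mem_iff b).1 (by simp)
  have h := (isPlanePath_singleton a).append (l := []) hY (by rwa [Set.singleton_union]) ?_ hab
    (sees_singleton b a)
  · rwa [Set.singleton_union] at h
  · rw [convexHull_singleton, Set.disjoint_singleton_left]
    intro ha
    have := hab a (left_mem_segment ℝ a b) ha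
    exact haY (this ▸ hbY)

/-- From a vertex `a` of the convex hull of `X` starts a plane spanning path of `X`. -/
theorem exists_planePath (X : Finset Plane) : ∀ a ∈ X, a ∉ convexHull ℝ (X \ {a} : Set Plane) →
    InGeneralPosition (X : Set Plane) → ∃ l, IsPlanePath (X : Set Plane) (a :: l) := by
  induction X using Finset.strongInduction with
  | H X ih =>
    intro a ha hext hgen
    have hX : insert a ((X.erase a : Finset Plane) : Set Plane) = X := by
      rw [← Finset.coe_insert, Finset.insert_erase ha]
    rw [← Finset.coe_erase] at hext
    rcases (X.erase a).eq_empty_or_nonempty with h0 | h0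
    · refine ⟨[], ?_⟩
      rw [← hX, h0]
      simpa using isPlanePath_singleton a
    · obtain ⟨p, hp, hpx⟩ := exists_tangent h0 hext (by rwa [hX]) one_ne_zero
      obtain ⟨l, hl⟩ := ih _ (Finset.erase_ssubset ha) p hp
        (notMem_convexHull_of_forall_orient_pos hpx) (hgen.mono (by simp))
      exact ⟨p :: l, hX ▸ hl.cons (by rwa [hX]) (by simp) (sees_of_forall_orient_pos hpx)⟩

/-- Seen from outside, a set of at least two points has a point of contact with a tangent that
avoids a given point. -/
theorem exists_tangent_ne {X : Finset Plane} {q : Plane} (hX : 2 ≤ X.card)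
    (hq : q ∉ convexHull ℝ (X : Set Plane)) (hgen : InGeneralPosition (insert q (X : Set Plane)))
    (a : Plane) : ∃ σ : ℝ, σ ≠ 0 ∧ ∃ p ∈ X, p ≠ a ∧ ∀ x ∈ X, x ≠ p → 0 < σ * orient q p x := by
  have hne : X.Nonempty := Finset.card_pos.1 (by omega)
  obtain ⟨p, hp, hpx⟩ := exists_tangent hne hq hgen one_ne_zero
  obtain ⟨r, hr, hrx⟩ := exists_tangent hne hq hgen (neg_ne_zero.2 one_ne_zero)
  by_cases hpa : p = a
  · refine ⟨-1, by norm_num, r, hr, ?_, hrx⟩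
    rintro rfl
    subst hpa
    obtain ⟨y, hy, hyp⟩ := Finset.exists_mem_ne hX p
    have h1 := hpx y hy hyp
    have h2 := hrx y hy hyp
    linarith
  · exact ⟨1, one_ne_zero, p, hp, hpa, hpx⟩

/-- Two vertices `a ≠ b` of the convex hull of `X` are the ends of a plane spanning path of `X`. -/
theorem exists_planePath_between (X : Finset Plane) (b : Plane) :
    ∀ a ∈ X, b ∈ X → a ≠ b → a ∉ convexHull ℝ (X \ {a} : Set Plane) →
      b ∉ convexHull ℝ (X \ {b} : Set Plane) → InGeneralPosition (X : Set Plane) →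
      ∃ l, IsPlanePath (X : Set Plane) (a :: l ++ [b]) := by
  induction X using Finset.strongInduction with
  | H X ih =>
    intro a ha hb hab hexta hextb hgen
    have hX : insert a ((X.erase a : Finset Plane) : Set Plane) = X := by
      rw [← Finset.coe_insert, Finset.insert_erase ha]
    rw [← Finset.coe_erase] at hexta
    have hbe : b ∈ X.erase a := Finset.mem_erase.2 ⟨hab.symm, hb⟩
    by_cases h1 : (X.erase a).card = 1
    · obtain ⟨c, hc⟩ := Finset.card_eq_one.1 h1
      rw [hc, Finset.mem_singleton] at hbe
      subst hbe
      refine ⟨[], ?_⟩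
      have := (isPlanePath_singleton b).cons (a := a) (by
        rw [← Finset.coe_singleton, ← hc, hX]; exact hgen) (by simpa using hab) (sees_singleton a b)
      rwa [← Finset.coe_singleton, ← hc, hX] at this
    · have h2 : 2 ≤ (X.erase a).card := by
        have := Finset.card_pos.2 ⟨b, hbe⟩
        omega
      obtain ⟨σ, hσ, p, hp, hpb, hpx⟩ := exists_tangent_ne h2 hexta (by rwa [hX]) b
      obtain ⟨l, hl⟩ := ih _ (Finset.erase_ssubset ha) p hp hbe hpb
        (notMem_convexHull_of_forall_orient_pos hpx)
        (notMem_convexHull_mono hextb (by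
          intro x; simp only [Finset.coe_erase, Set.mem_sdiff, Finset.mem_coe]; tauto))
        (hgen.mono (by simp))
      exact ⟨p :: l, hX ▸ IsPlanePath.cons (l := l ++ [b]) hl (by rwa [hX]) (by simp)
        (sees_of_forall_orient_pos hpx)⟩

/-- The zigzag path. Let the balanced sets `A` and `B` be separated by a line, and let `q ∈ A` be
an end of a bridge. Then there is a plane spanning path from `q` which alternates between `A` and
`B`: it always goes on to the opposite end of the bridge of the points that remain. -/
theorem exists_zigzag (n : ℕ) : ∀ (A B : Finset Plane) (q : Plane) (φ : Plane →ᵃ[ℝ] ℝ) (σ : ℝ),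
    A.card + B.card = n → B.card ≤ A.card → A.card ≤ B.card + 1 → q ∈ A → σ ≠ 0 →
    (∀ a ∈ A, φ a < 0) → (∀ b ∈ B, 0 < φ b) → InGeneralPosition (A ∪ B : Set Plane) →
    (B.Nonempty → ∃ b ∈ B, ∀ x ∈ (A ∪ B : Set Plane), x ≠ q → x ≠ b → σ * orient q b x < 0) →
    ∃ l, IsPlanePath (A ∪ B : Set Plane) (q :: l) ∧
      ∀ e ∈ pathEdges (q :: l), ∃ a ∈ A, ∃ b ∈ B, e = s(a, b) := by
  induction n with
  | zero =>
    intro A B q φ σ hn _ _ hq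
    have := Finset.card_pos.2 ⟨q, hq⟩
    omega
  | succ n ih =>
    intro A B q φ σ hn hBA hAB hq hσ hφA hφB hgen hbr
    have hqB : q ∉ B := fun h => absurd (hφA q hq) (not_lt.2 (hφB q h).le)
    have hA : insert q ((A.erase q : Finset Plane) : Set Plane) = A := by
      rw [← Finset.coe_insert, Finset.insert_erase hq]
    rcases B.eq_empty_or_nonempty with rfl | hB
    · obtain ⟨c, rfl⟩ := Finset.card_eq_one.1 (show A.card = 1 by
        have := Finset.card_pos.2 ⟨q, hq⟩
        simp at hAB; omega)
      obtain rfl := Finset.mem_singleton.1 hq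
      exact ⟨[], by simpa using isPlanePath_singleton q, by simp [pathEdges]⟩
    obtain ⟨b, hb, hbx⟩ := hbr hB
    rcases (A.erase q).eq_empty_or_nonempty with h0 | h0
    · have hA1 : A.card = 1 := by
        have := Finset.card_erase_of_mem hq
        rw [h0, Finset.card_empty] at this
        have := Finset.card_pos.2 ⟨q, hq⟩
        omega
      have hB1 : B.card = 1 := by
        have := Finset.card_pos.2 hB
        omega
      obtain ⟨c, rfl⟩ := Finset.card_eq_one.1 hB1
      obtain rfl := Finset.mem_singleton.1 hb
      have hAB : (A ∪ ({b} : Finset Plane) : Set Plane) = insert q {b} := by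
        rw [← hA, h0]; simp [Set.pair_comm]
      rw [hAB] at hgen ⊢
      refine ⟨[b], (isPlanePath_singleton b).cons hgen (by simpa using hqB)
        (sees_singleton q b), ?_⟩
      intro e he
      simp only [pathEdges, List.mem_singleton] at he
      exact ⟨q, hq, b, hb, he⟩
    · have hAA : ∀ a ∈ A.erase q, a ∈ A := fun a => Finset.mem_of_mem_erase
      have hAB' : (B ∪ (A.erase q : Finset Plane) : Set Plane) ⊆ A ∪ B := by
        rw [← hA]; intro x; simp only [Set.mem_union, Set.mem_insert_iff]; tauto
      have hABi : insert q (B ∪ (A.erase q : Finset Plane) : Set Plane) = (A : Set Plane) ∪ B := by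
        rw [Set.union_comm, ← Set.insert_union, hA]
      obtain ⟨a', ha', b', hb', hbr'⟩ := exists_bridge h0 hB
        (hgen.mono (by rwa [Set.union_comm])) φ (fun a ha => hφA a (hAA a ha)) hφB hσ
      have haq : a' ≠ q := Finset.ne_of_mem_erase ha'
      have hne : ∀ a ∈ A, ∀ b ∈ B, a ≠ b := fun a ha b hb hab =>
        absurd (hφA a ha) (not_lt.2 (hab ▸ (hφB b hb).le))
      have hpos : 0 < σ * orient a' b' q := by
        refine orient_pos_of_bridges φ (hφA q hq) (hφB b hb) (hφA a' (hAA a' ha')) (hφB b' hb')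
          haq ?_ ?_ ?_
        · rintro x (rfl | rfl) h1 h2
          · exact hbx x (Or.inl (hAA x ha')) h1 h2
          · exact hbx x (Or.inr hb') h1 h2
        · intro hbb
          exact hbr' b (Or.inr hb) (hne a' (hAA a' ha') b hb).symm hbb
        · exact mul_ne_zero hσ (hgen.orient_ne_zero (Or.inl (hAA a' ha')) (Or.inr hb') (Or.inl hq)
            (hne a' (hAA a' ha') b' hb') haq (hne q hq b' hb').symm)
      have hcard := Finset.card_erase_of_mem hq
      obtain ⟨l, hl, hle⟩ := ih B (A.erase q) b' (-φ) (-σ) (by omega) (by omega) (by omega) hb'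
        (neg_ne_zero.2 hσ) (by simpa using hφB)
        (fun a ha => by simpa using hφA a (hAA a ha)) (hgen.mono hAB')
        (fun _ => ⟨a', ha', fun x hx h1 h2 => by
          rw [orient_swap, neg_mul_neg]
          exact hbr' x (by rwa [Set.union_comm]) h2 h1⟩)
      refine ⟨b' :: l, hABi ▸ hl.cons (by rwa [hABi]) (by simp [hqB]) ?_, ?_⟩
      · exact sees_of_bridge hpos fun x hx => hbr' x (by rwa [Set.union_comm])
      · intro e he
        rw [pathEdges, List.mem_cons] at he
        rcases he with rfl | he
        · exact ⟨q, hq, b', hb', rfl⟩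
        · obtain ⟨b₁, hb₁, a₁, ha₁, rfl⟩ := hle e he
          exact ⟨a₁, hAA a₁ ha₁, b₁, hb₁, Sym2.eq_swap⟩

/-! ### Splitting a set by a line through a vertex of the hull -/

/-- The first `j` points of `X` in the radial order around a point `t` outside its hull. -/
theorem exists_radial_split {X : Finset Plane} {t : Plane}
    (ht : t ∉ convexHull ℝ (X : Set Plane)) (hgen : InGeneralPosition (insert t (X : Set Plane)))
    {σ : ℝ} (hσ : σ ≠ 0) (j : ℕ) (hj : j ≤ X.card) :
    ∃ L ⊆ X, L.card = j ∧ ∀ l ∈ L, ∀ r ∈ X \ L, 0 < σ * orient t l r := by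
  induction j with
  | zero => exact ⟨∅, by simp, by simp, by simp⟩
  | succ j ih =>
    obtain ⟨L, hLX, hLj, hL⟩ := ih (by omega)
    have hsub : ((X \ L : Finset Plane) : Set Plane) ⊆ X := by
      exact_mod_cast Finset.sdiff_subset
    have hne : (X \ L).Nonempty := by
      rw [← Finset.card_pos, Finset.card_sdiff_of_subset hLX]; omega
    obtain ⟨p, hp, hpx⟩ := exists_tangent hne (notMem_convexHull_mono ht hsub)
      (hgen.mono (Set.insert_subset_insert hsub)) hσ
    rw [Finset.mem_sdiff] at hp
    refine ⟨insert p L, Finset.insert_subset hp.1 hLX, by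
      rw [Finset.card_insert_of_notMem hp.2, hLj], fun l hl r hr => ?_⟩
    rw [Finset.mem_sdiff, Finset.mem_insert, not_or] at hr
    rcases Finset.mem_insert.1 hl with rfl | hl
    · exact hpx r (Finset.mem_sdiff.2 ⟨hr.1, hr.2.2⟩) hr.2.1
    · exact hL l hl r (Finset.mem_sdiff.2 ⟨hr.1, hr.2.2⟩)

/-- If `A` precedes `B` in the radial order around `t`, then a line through `t` separates `A`
from `B`. -/
theorem exists_separating_line {A B : Finset Plane} {t : Plane} (hA : A.Nonempty)
    (hB : B.Nonempty) (ht : t ∉ convexHull ℝ (A ∪ B : Set Plane))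
    (hgen : InGeneralPosition (insert t (A ∪ B : Set Plane))) {σ : ℝ} (hσ : σ ≠ 0)
    (h : ∀ a ∈ A, ∀ b ∈ B, 0 < σ * orient t a b) :
    ∃ φ : Plane →ᵃ[ℝ] ℝ, φ t = 0 ∧ (∀ a ∈ A, φ a < 0) ∧ ∀ b ∈ B, 0 < φ b := by
  have hAs : (A : Set Plane) ⊆ A ∪ B := Set.subset_union_left
  have hBs : (B : Set Plane) ⊆ A ∪ B := Set.subset_union_right
  obtain ⟨p, hp, hpx⟩ := exists_tangent hA (notMem_convexHull_mono ht hAs)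
    (hgen.mono (Set.insert_subset_insert hAs)) (neg_ne_zero.2 hσ)
  obtain ⟨q, hq, hqx⟩ := exists_tangent hB (notMem_convexHull_mono ht hBs)
    (hgen.mono (Set.insert_subset_insert hBs)) hσ
  -- the sum of the lines to the last point of `A` and to the first point of `B`
  refine ⟨σ • (orient t p + orient t q), by simp [orient_self_left], fun a ha => ?_, fun b hb => ?_⟩
  · have h1 := h a ha q hq
    rw [orient_swap_right] at h1
    have h2 : σ * orient t p a ≤ 0 := by
      by_cases hap : a = p
      · simp [hap, orient_self_right]
      · have := hpx a ha hap
        linarith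
    simp only [AffineMap.coe_smul, AffineMap.coe_add, Pi.smul_apply, Pi.add_apply, smul_eq_mul]
    linarith
  · have h1 := h p hp b hb
    have h2 : 0 ≤ σ * orient t q b := by
      by_cases hbq : b = q
      · simp [hbq, orient_self_right]
      · exact (hqx b hb hbq).le
    simp only [AffineMap.coe_smul, AffineMap.coe_add, Pi.smul_apply, Pi.add_apply, smul_eq_mul]
    linarith

theorem disjoint_convexHull {X Y : Set Plane} (φ : Plane →ᵃ[ℝ] ℝ) (hX : ∀ x ∈ X, φ x ≤ 0)
    (hY : ∀ y ∈ Y, 0 < φ y) : Disjoint (convexHull ℝ X) (convexHull ℝ Y) := by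
  rw [Set.disjoint_left]
  intro x hx
  refine notMem_convexHull_of_pos φ ?_ hY
  simpa using nonneg_of_mem_convexHull (-φ) (by simpa using hX) hx

/-! ### Disjoint paths from different points -/

/-- The set `S` has edge-disjoint plane spanning paths from `s` and from `t` which, for `s ≠ t`,
do not contain the edge `s t`. -/
def HasDisjointPaths (S : Set Plane) (s t : Plane) : Prop :=
  ∃ l m : List Plane, IsPlanePath S (s :: l) ∧ IsPlanePath S (t :: m) ∧
    List.Disjoint (pathEdges (s :: l)) (pathEdges (t :: m)) ∧
    (s ≠ t → s(s, t) ∉ pathEdges (s :: l) ∧ s(s, t) ∉ pathEdges (t :: m))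

/-- The case of a line through `t` that halves the other points, `s` being in the smaller half `L`.
The path from `t` goes to the bridge of `L` and `R` and zigzags; the path from `s` visits `L`
first, comes to `t` last, and goes on to `R`. -/
theorem hasDisjointPaths_of_halving {L R : Finset Plane} {s t : Plane} {σ : ℝ} (hσ : σ ≠ 0)
    (hgen : InGeneralPosition (insert t (L ∪ R : Set Plane)))
    (ht : t ∉ convexHull ℝ (L ∪ R : Set Plane))
    (hs : s ∉ convexHull ℝ (insert t (L ∪ R : Set Plane) \ {s}))
    (hor : ∀ l ∈ L, ∀ r ∈ R, 0 < σ * orient t l r)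
    (hL2 : 2 ≤ L.card) (hLR : L.card ≤ R.card) (hRL : R.card ≤ L.card + 1) (hsL : s ∈ L) :
    HasDisjointPaths (insert t (L ∪ R : Set Plane)) s t := by
  have hLne : L.Nonempty := Finset.card_pos.1 (by omega)
  have hRne : R.Nonempty := Finset.card_pos.1 (by omega)
  have htLR : t ∉ (L ∪ R : Set Plane) := fun h => ht (subset_convexHull ℝ _ h)
  have htL : t ∉ L := fun h => htLR (Or.inl h)
  have htR : t ∉ R := fun h => htLR (Or.inr h)
  have hst : s ≠ t := fun h => htL (h ▸ hsL)
  obtain ⟨φ, hφt, hφL, hφR⟩ := exists_separating_line hLne hRne ht hgen hσ hor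
  have hdis : ∀ x ∈ L, x ∉ R := fun x h1 h2 => absurd (hφL x h1) (not_lt.2 (hφR x h2).le)
  have hgLR : InGeneralPosition (L ∪ R : Set Plane) := hgen.mono (Set.subset_insert _ _)
  obtain ⟨a, ha, b, hb, hab⟩ := exists_bridge hLne hRne hgLR φ hφL hφR hσ
  -- the path from `t`
  obtain ⟨m, hm, hme⟩ := exists_zigzag _ R L b (-φ) (-σ) rfl hLR hRL hb (neg_ne_zero.2 hσ)
    (by simpa using hφR) (by simpa using hφL) (by rwa [Set.union_comm])
    (fun _ => ⟨a, ha, fun x hx h1 h2 => by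
      rw [orient_swap, neg_mul_neg]
      exact hab x (by rwa [Set.union_comm]) h2 h1⟩)
  rw [Set.union_comm] at hm
  have hQ := hm.cons hgen htLR
    (sees_of_bridge (by rw [← orient_rotate, ← orient_rotate]; exact hor a ha b hb) hab)
  -- the path from `s`
  have hLt : ((insert t L : Finset Plane) : Set Plane) ⊆ insert t (L ∪ R : Set Plane) := by
    intro x; simp only [Finset.coe_insert, Set.mem_insert_iff, Set.mem_union]; tauto
  obtain ⟨l₁, hl₁⟩ := exists_planePath_between (insert t L) t s (by simp [hsL]) (by simp) hst
    (notMem_convexHull_mono hs (Set.sdiff_subset_sdiff_left hLt))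
    (notMem_convexHull_mono ht (by
      intro x
      simp only [Finset.coe_insert, Set.mem_sdiff, Set.mem_insert_iff, Set.mem_singleton_iff,
        Set.mem_union]
      tauto))
    (hgen.mono hLt)
  have hRs : (R : Set Plane) ⊆ L ∪ R := Set.subset_union_right
  obtain ⟨τ, hτ, c, hc, hcb, hcx⟩ := exists_tangent_ne (by omega : 2 ≤ R.card)
    (notMem_convexHull_mono ht hRs) (hgen.mono (Set.insert_subset_insert hRs)) b
  obtain ⟨l₂, hl₂⟩ := exists_planePath R c hc (notMem_convexHull_of_forall_orient_pos hcx)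
    (hgLR.mono hRs)
  have hU : ((insert t L : Finset Plane) ∪ R : Set Plane) = insert t (L ∪ R : Set Plane) := by
    rw [Finset.coe_insert, Set.insert_union]
  have hφtL : ∀ x ∈ insert t L, φ x ≤ 0 := by
    intro x hx
    rcases Finset.mem_insert.1 hx with rfl | hx
    · exact hφt.le
    · exact (hφL x hx).le
  have hP := hl₁.append hl₂ (by rwa [hU]) (disjoint_convexHull φ hφtL hφR)
    (sees_of_forall_orient_pos hcx)
    (sees_of_neg (-φ) (by simpa using hφR c hc) (by simpa using hφt) (by simpa using hφtL))
  rw [hU] at hP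
  have hPe : ∀ x y, s(x, y) ∈ pathEdges (s :: l₁ ++ [t] ++ c :: l₂) →
      s(x, y) ∈ pathEdges (s :: l₁ ++ [t]) ∨ s(x, y) = s(t, c) ∨ x ∈ R ∧ y ∈ R := by
    intro x y h
    rw [pathEdges_append, List.mem_append, List.mem_cons] at h
    exact h.imp_right (Or.imp_right hl₂.edge_mem)
  have hPL : ∀ x y, s(x, y) ∈ pathEdges (s :: l₁ ++ [t]) → x ∈ insert t L ∧ y ∈ insert t L :=
    fun x y h => hl₁.edge_mem h
  have hsR := hdis s hsL
  refine ⟨_, _, hP, hQ, ?_, fun _ => ⟨fun h => ?_, fun h => ?_⟩⟩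
  · intro e he hf
    rw [pathEdges, List.mem_cons] at hf
    rcases hf with rfl | hf
    · rcases hPe _ _ he with h | h | h
      · have := hPL _ _ h
        simp only [Finset.mem_insert] at this
        rcases this.2 with rfl | h
        · exact htR hb
        · exact hdis _ h hb
      · rcases Sym2.eq_iff.1 h with ⟨_, h⟩ | ⟨h, _⟩
        · exact hcb h.symm
        · exact htR (h ▸ hc)
      · exact htR h.1
    · obtain ⟨r, hr, l, hl, rfl⟩ := hme e hf
      rcases hPe _ _ he with h | h | h
      · have := hPL _ _ h
        simp only [Finset.mem_insert] at this
        rcases this.1 with rfl | h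
        · exact htR hr
        · exact hdis _ h hr
      · rcases Sym2.eq_iff.1 h with ⟨h, _⟩ | ⟨_, h⟩
        · exact htR (h ▸ hr)
        · exact htL (h ▸ hl)
      · exact hdis _ hl h.2
  · rcases hPe _ _ h with h | h | h
    · cases l₁ with
      | nil =>
        -- `L` has a second point besides `s`, so the path in `L` has an interior point
        obtain ⟨y, hy, hys⟩ := Finset.exists_mem_ne hL2 s
        have := (hl₁.mem_iff y).2 (by simp [hy])
        simp only [List.cons_append, List.nil_append, List.mem_cons, List.not_mem_nil,
          or_false] at this
        rcases this with h | h
        · exact hys h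
        · exact htL (h ▸ hy)
      | cons x l₁ =>
        have hx := eq_of_mem_pathEdges_cons hl₁.nodup h
        have := (List.nodup_cons.1 (List.nodup_cons.1 hl₁.nodup).2).1
        exact this (by simp [← hx])
    · rcases Sym2.eq_iff.1 h with ⟨h, _⟩ | ⟨h, _⟩
      · exact hst h
      · exact hsR (h ▸ hc)
    · exact hsR h.1
  · rw [Sym2.eq_swap] at h
    have := eq_of_mem_pathEdges_cons hQ.nodup h
    exact hsR (this ▸ hb)

/-! ### The case in which the line through `s` and `t` halves the set -/

/-- Two vertices `s`, `t` of the convex hull of a finite set, the line through which splits the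
other points into `L` and `R`; the sign `σ` tells which side is which. -/
structure DiagonalSplit (L R : Finset Plane) (s t : Plane) (σ : ℝ) : Prop where
  sign_ne : σ ≠ 0
  gen : InGeneralPosition (insert t (insert s (L ∪ R : Set Plane)))
  ext_t : t ∉ convexHull ℝ (insert s (L ∪ R : Set Plane))
  ext_s : s ∉ convexHull ℝ (insert t (L ∪ R : Set Plane))
  neg : ∀ l ∈ L, σ * orient t s l < 0
  pos : ∀ r ∈ R, 0 < σ * orient t s r

namespace DiagonalSplit

variable {L R : Finset Plane} {s t : Plane} {σ : ℝ}

theorem symm (h : DiagonalSplit L R s t σ) : DiagonalSplit R L s t (-σ) where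
  sign_ne := neg_ne_zero.2 h.sign_ne
  gen := by rw [Set.union_comm]; exact h.gen
  ext_t := by rw [Set.union_comm]; exact h.ext_t
  ext_s := by rw [Set.union_comm]; exact h.ext_s
  neg := fun r hr => by have := h.pos r hr; linarith
  pos := fun l hl => by have := h.neg l hl; linarith

theorem orient_t_pos (h : DiagonalSplit L R s t σ) {l r : Plane} (hl : l ∈ L) (hr : r ∈ R) :
    0 < σ * orient t l r :=
  orient_pos_of_diagonal (((L ∪ R).finite_toSet.insert s).subset (by simp)) h.ext_t
    (Set.mem_insert _ _) (Or.inr (Or.inl hl)) (Or.inr (Or.inr hr)) (h.neg l hl) (h.pos r hr)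

theorem orient_s_neg (h : DiagonalSplit L R s t σ) {l r : Plane} (hl : l ∈ L) (hr : r ∈ R) :
    σ * orient s l r < 0 := by
  have := orient_pos_of_diagonal (σ := -σ) (((L ∪ R).finite_toSet.insert t).subset (by simp))
    h.ext_s (Set.mem_insert _ _) (Or.inr (Or.inl hl)) (Or.inr (Or.inr hr))
    (by rw [orient_swap, neg_mul_neg]; exact h.neg l hl)
    (by rw [orient_swap, neg_mul_neg]; exact h.pos r hr)
  linarith

theorem s_notMem_L (h : DiagonalSplit L R s t σ) : s ∉ L := fun hs => by
  have := h.neg s hs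
  simp [orient_self_right] at this

theorem t_notMem_L (h : DiagonalSplit L R s t σ) : t ∉ L := fun ht => by
  have := h.neg t ht
  simp [orient_self_left] at this

theorem disjoint (h : DiagonalSplit L R s t σ) : ∀ x ∈ L, x ∉ R := fun x h1 h2 =>
  absurd (h.neg x h1) (not_lt.2 (h.pos x h2).le)

theorem ne (h : DiagonalSplit L R s t σ) : s ≠ t := by
  rintro rfl
  exact h.ext_s (subset_convexHull ℝ _ (Set.mem_insert _ _))

/-- The line through `s` and `t` can be rotated around `t` so as to leave `s` on the side
of `L`. -/
theorem exists_line (h : DiagonalSplit L R s t σ) (hR : R.Nonempty) :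
    ∃ φ : Plane →ᵃ[ℝ] ℝ, φ t = 0 ∧ (∀ a ∈ insert s L, φ a < 0) ∧ ∀ b ∈ R, 0 < φ b := by
  refine exists_separating_line (by simp) hR (notMem_convexHull_mono h.ext_t ?_)
    (h.gen.mono ?_) h.sign_ne ?_
  · simp [Set.insert_union]
  · simp [Set.insert_union]
  · intro a ha b hb
    rcases Finset.mem_insert.1 ha with rfl | ha
    · exact h.pos b hb
    · exact h.orient_t_pos ha hb

/-- The line through `s` and the point `c` of `L` next to `t` supports `L ∪ {s}`, so that all points
beyond it see `c`. -/
theorem sees_neg_side (h : DiagonalSplit L R s t σ) {c : Plane}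
    (hc : ∀ x ∈ L, x ≠ c → 0 < σ * orient s c x) {a : Plane} (ha : σ * orient s c a < 0) :
    Sees a c (insert s L : Finset Plane) := by
  refine sees_of_neg (σ • orient s c) (by simpa using ha) (by simp [orient_self_right]) ?_
  intro x hx
  rcases Finset.mem_insert.1 hx with rfl | hx
  · simp [orient_self_left]
  · by_cases hxc : x = c
    · simp [hxc, orient_self_right]
    · simpa using (hc x hx hxc).le

/-- There is a plane spanning path of `L ∪ {s}` from `s` to the point of `L` that is the next one
to `t` as seen from `s`. -/
theorem exists_path (h : DiagonalSplit L R s t σ) {c : Plane} (hcL : c ∈ L)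
    (hc : ∀ x ∈ L, x ≠ c → 0 < σ * orient s c x) :
    ∃ l, IsPlanePath (insert s L : Finset Plane) (s :: l ++ [c]) := by
  have hsc : s ≠ c := fun hsc => h.s_notMem_L (hsc ▸ hcL)
  refine exists_planePath_between (insert s L) c s (by simp) (by simp [hcL]) hsc
    (notMem_convexHull_mono h.ext_s ?_) ?_ (h.gen.mono ?_)
  · intro x
    simp only [Finset.coe_insert, Set.mem_sdiff, Set.mem_insert_iff, Set.mem_singleton_iff,
      Set.mem_union]
    tauto
  · intro hcc
    refine hsc.symm (eq_of_mem_convexHull (σ • orient s c) (by simp [orient_self_left]) ?_ hcc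
      (by simp [orient_self_right]))
    rintro x ⟨hx, hxc⟩ hxs
    rcases Finset.mem_insert.1 hx with rfl | hx
    · exact absurd rfl hxs
    · simpa using hc x hx hxc
  · intro x
    simp only [Finset.coe_insert, Set.mem_insert_iff, Set.mem_union]
    tauto

theorem union_eq : ((insert s L : Finset Plane) ∪ (insert t R : Finset Plane) : Set Plane) =
    insert t (insert s (L ∪ R : Set Plane)) := by
  ext x
  simp only [Finset.coe_insert, Set.mem_insert_iff, Set.mem_union]
  tauto

theorem disjoint_hulls (h : DiagonalSplit L R s t σ) (hR : R.Nonempty) :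
    Disjoint (convexHull ℝ ((insert s L : Finset Plane) : Set Plane))
      (convexHull ℝ ((insert t R : Finset Plane) : Set Plane)) := by
  obtain ⟨φ, hφt, hφL, hφR⟩ := h.exists_line hR
  refine (disjoint_convexHull (-φ) ?_ ?_).symm
  · intro x hx
    rcases Finset.mem_insert.1 hx with rfl | hx
    · simp [hφt]
    · simpa using (hφR x hx).le
  · simpa using hφL

/-- The easy case: the bridge of `L` and `R` does not end in the point `c` of `L` that is the next
one to `t` as seen from `s`. The path from `s` visits `L`, comes to `c`, and goes on through `t`
to `R`; the path from `t` goes to the end `b` of the bridge in `L` and zigzags. -/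
theorem hasDisjointPaths_of_ne (h : DiagonalSplit L R s t σ) (hLR : L.card = R.card)
    {b q c : Plane} (hbL : b ∈ L) (hqR : q ∈ R)
    (hbq : ∀ x ∈ (L ∪ R : Set Plane), x ≠ b → x ≠ q → σ * orient b q x < 0)
    (hcL : c ∈ L) (hc : ∀ x ∈ L, x ≠ c → 0 < σ * orient s c x) (hbc : b ≠ c) :
    HasDisjointPaths (insert t (insert s (L ∪ R : Set Plane))) s t := by
  have hRne : R.Nonempty := ⟨q, hqR⟩
  obtain ⟨φ, hφt, hφL, hφR⟩ := h.exists_line hRne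
  have htR := h.symm.t_notMem_L
  have htL := h.t_notMem_L
  have hsR := h.symm.s_notMem_L
  have hsL := h.s_notMem_L
  have hU : ((insert s L : Finset Plane) ∪ R : Set Plane) = insert s (L ∪ R : Set Plane) := by
    rw [Finset.coe_insert, Set.insert_union]
  have hbq' : ∀ x ∈ insert s (L ∪ R : Set Plane), x ≠ b → x ≠ q → σ * orient b q x < 0 := by
    rintro x (rfl | hx) h1 h2
    · rw [← orient_rotate, ← orient_rotate]; exact h.orient_s_neg hbL hqR
    · exact hbq x hx h1 h2
  -- the path from `t`
  have hcard : (insert s L).card = L.card + 1 := Finset.card_insert_of_notMem hsL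
  obtain ⟨m, hm, hme⟩ := exists_zigzag _ (insert s L) R b φ σ rfl (by omega) (by omega)
    (by simp [hbL]) h.sign_ne hφL hφR (by rw [hU]; exact h.gen.mono (Set.subset_insert _ _))
    (fun _ => ⟨q, hqR, by rwa [hU]⟩)
  rw [hU] at hm
  have hQ := hm.cons h.gen (fun ht => h.ext_t (subset_convexHull ℝ _ ht))
    (sees_of_bridge (a := q) (σ := -σ) (by
      have := h.orient_t_pos hbL hqR
      rw [orient_swap, neg_mul_neg, ← orient_rotate, ← orient_rotate]; exact this)
      (fun x hx h1 h2 => by rw [orient_swap, neg_mul_neg]; exact hbq' x hx h2 h1))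
  -- the path from `s`
  obtain ⟨l₁, hl₁⟩ := h.exists_path hcL hc
  have hRt : ((insert t R : Finset Plane) : Set Plane) ⊆
      insert t (insert s (L ∪ R : Set Plane)) := by
    intro x; simp only [Finset.coe_insert, Set.mem_insert_iff, Set.mem_union]; tauto
  obtain ⟨l₂, hl₂⟩ := exists_planePath (insert t R) t (by simp)
    (notMem_convexHull_mono h.ext_t (by
      intro x
      simp only [Finset.coe_insert, Set.mem_sdiff, Set.mem_insert_iff, Set.mem_singleton_iff,
        Set.mem_union]
      tauto))
    (h.gen.mono hRt)
  have hP := hl₁.append hl₂ (by rw [union_eq]; exact h.gen) (h.disjoint_hulls hRne)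
    (sees_of_neg φ (hφL c (by simp [hcL])) hφt (by
      intro x hx
      rcases Finset.mem_insert.1 hx with rfl | hx
      · exact hφt.ge
      · exact (hφR x hx).le))
    (h.sees_neg_side hc (by rw [orient_rotate]; exact h.neg c hcL))
  rw [union_eq] at hP
  have hPe : ∀ x y, s(x, y) ∈ pathEdges (s :: l₁ ++ [c] ++ t :: l₂) →
      (x ∈ insert s L ∧ y ∈ insert s L) ∨ s(x, y) = s(c, t) ∨ x ∈ insert t R ∧ y ∈ insert t R := by
    intro x y h
    rw [pathEdges_append, List.mem_append, List.mem_cons] at h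
    exact h.imp hl₁.edge_mem (Or.imp_right hl₂.edge_mem)
  have hst := h.ne
  have hdis := h.disjoint
  simp only [Finset.mem_insert] at hPe hme
  refine ⟨_, _, hP, hQ, ?_, fun _ => ⟨fun hmem => ?_, fun hmem => ?_⟩⟩
  · intro e he hf
    rw [pathEdges, List.mem_cons] at hf
    rcases hf with rfl | hf
    · rcases hPe _ _ he with ⟨h1 | h1, -⟩ | h1 | ⟨-, h1 | h1⟩
      · exact hst h1.symm
      · exact htL h1
      · rcases Sym2.eq_iff.1 h1 with ⟨h1, _⟩ | ⟨_, h1⟩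
        · exact htL (h1 ▸ hcL)
        · exact hbc h1
      · exact htL (h1 ▸ hbL)
      · exact hdis b hbL h1
    · obtain ⟨x, hx, y, hy, rfl⟩ := hme e hf
      rcases hPe _ _ he with ⟨-, h1 | h1⟩ | h1 | ⟨h1 | h1, -⟩
      · exact hsR (h1 ▸ hy)
      · exact hdis _ h1 hy
      · rcases Sym2.eq_iff.1 h1 with ⟨_, h1⟩ | ⟨_, h1⟩
        · exact htR (h1 ▸ hy)
        · exact hdis _ hcL (h1 ▸ hy)
      · rcases hx with h2 | h2
        · exact hst (h2.symm.trans h1)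
        · exact htL (h1 ▸ h2)
      · rcases hx with h2 | h2
        · exact hsR (h2 ▸ h1)
        · exact hdis x h2 h1
  · rcases hPe _ _ hmem with ⟨-, h1 | h1⟩ | h1 | ⟨h1 | h1, -⟩
    · exact hst h1.symm
    · exact htL h1
    · rcases Sym2.eq_iff.1 h1 with ⟨h1, _⟩ | ⟨h1, _⟩
      · exact hsL (h1 ▸ hcL)
      · exact hst h1
    · exact hst h1
    · exact hsR h1
  · rw [Sym2.eq_swap] at hmem
    exact hsL (eq_of_mem_pathEdges_cons hQ.nodup hmem ▸ hbL)

/-- The hard case: both ends `b` and `q` of the bridge of `L` and `R` are the points next to `t`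
on their sides as seen from `s`. Then `q` is an end of a bridge again when `b` is removed, so that
a zigzag can start with `t`, `b`, `q`. This leaves to the other path, which visits `L` from `s` to
`b`, the tangents from `b` to the points on the other side. -/
theorem hasDisjointPaths_of_eq (h : DiagonalSplit L R s t σ) (hLR : L.card = R.card)
    (hL2 : 2 ≤ L.card) {b q : Plane} (hbL : b ∈ L) (hqR : q ∈ R)
    (hbq : ∀ x ∈ (L ∪ R : Set Plane), x ≠ b → x ≠ q → σ * orient b q x < 0)
    (hb : ∀ x ∈ L, x ≠ b → 0 < σ * orient s b x) (hq : ∀ x ∈ R, x ≠ q → σ * orient s q x < 0) :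
    HasDisjointPaths (insert t (insert s (L ∪ R : Set Plane))) s t := by
  have hRne : R.Nonempty := ⟨q, hqR⟩
  obtain ⟨φ, hφt, hφL, hφR⟩ := h.exists_line hRne
  have htR := h.symm.t_notMem_L
  have htL := h.t_notMem_L
  have hsR := h.symm.s_notMem_L
  have hsL := h.s_notMem_L
  have hst := h.ne
  have hdis := h.disjoint
  have hbR := hdis b hbL
  have hbs : b ≠ s := fun hbs => hsL (hbs ▸ hbL)
  have hgen' : InGeneralPosition (insert s (L ∪ R : Set Plane)) :=
    h.gen.mono (Set.subset_insert _ _)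
  have hbq' : ∀ x ∈ insert s (L ∪ R : Set Plane), x ≠ b → x ≠ q → σ * orient b q x < 0 := by
    rintro x (rfl | hx) h1 h2
    · rw [← orient_rotate, ← orient_rotate]; exact h.orient_s_neg hbL hqR
    · exact hbq x hx h1 h2
  -- the path from `t`
  let Y := insert s (L.erase b)
  have hbY : b ∉ Y := by simp [Y, hbs]
  have hYL : ∀ y ∈ Y, y ∈ insert s L := Finset.insert_subset_insert s (Finset.erase_subset b L)
  have hU : insert b (R ∪ Y : Set Plane) = insert s (L ∪ R : Set Plane) := by
    ext x
    simp only [Y, Finset.coe_insert, Finset.coe_erase, Set.mem_insert_iff, Set.mem_union,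
      Set.mem_sdiff, Set.mem_singleton_iff, Finset.mem_coe]
    constructor
    · rintro (rfl | h | h | h) <;> tauto
    · tauto
  have hRY : (R ∪ Y : Set Plane) ⊆ insert s (L ∪ R : Set Plane) := hU ▸ Set.subset_insert _ _
  have hqR' : q ∉ convexHull ℝ (Y : Set Plane) := by
    refine notMem_convexHull_of_pos (-φ) (by simpa using (hφR q hqR).le) (fun y hy => ?_)
    simpa using hφL y (hYL y hy)
  have hYq : insert q (Y : Set Plane) ⊆ insert s (L ∪ R : Set Plane) :=
    Set.insert_subset (hRY (Or.inl hqR)) (fun y hy => hRY (Or.inr hy))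
  obtain ⟨p, hpY, hp⟩ := exists_tangent (by simp [Y]) hqR' (hgen'.mono hYq) h.sign_ne
  have hpb : p ≠ b := fun hpb => hbY (hpb ▸ hpY)
  have hpq : p ≠ q := by
    rintro rfl
    exact absurd (hφL p (hYL p hpY)) (not_lt.2 (hφR p hqR).le)
  have hqbp : 0 < σ * orient q b p := by
    rw [orient_swap]
    have := hbq' p (hRY (Or.inr hpY)) hpb hpq
    linarith
  -- seen from `q`, the direction of `p` is between those of `s` and `b`
  have hqp : ∀ x ∈ (R ∪ Y : Set Plane), x ≠ q → x ≠ p → σ * orient p q x < 0 := by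
    rintro x (hx | hx) h1 h2
    · have hid : orient q b s * orient q p x =
          orient q p s * orient q b x + orient q b p * orient q s x := by
        simp only [orient_apply]; ring
      have e1 : 0 < σ * orient q b s := by
        have := h.orient_s_neg hbL hqR
        have h0 : orient q b s = -orient s b q := by simp only [orient_apply]; ring
        rw [h0]; linarith
      have e2 : 0 ≤ σ * orient q p s := by
        by_cases hps : s = p
        · simp [hps, orient_self_right]
        · exact (hp s (by simp [Y]) hps).le
      have e3 : 0 < σ * orient q b x := by
        have := hbq x (Or.inr hx) (fun hxb => hbR (hxb ▸ hx)) h1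
        rw [orient_swap]; linarith
      have e4 : 0 < σ * orient q s x := by
        have := hq x hx h1
        rw [orient_swap]; linarith
      have e5 : 0 < (σ * orient q b s) * (σ * orient q p x) := by
        have : (σ * orient q b s) * (σ * orient q p x) =
          (σ * orient q p s) * (σ * orient q b x) + (σ * orient q b p) * (σ * orient q s x) := by
          linear_combination σ ^ 2 * hid
        rw [this]
        positivity
      have := pos_of_mul_pos_right e5 e1.le
      rw [orient_swap]; linarith
    · have := hp x hx h2
      rw [orient_swap]; linarith
  have hcard : Y.card = L.card := by
    have h1 := Finset.card_erase_of_mem hbL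
    have h2 : Y.card = (L.erase b).card + 1 :=
      Finset.card_insert_of_notMem (fun hs => hsL (Finset.mem_of_mem_erase hs))
    omega
  obtain ⟨m, hm, hme⟩ := exists_zigzag _ R Y q (-φ) (-σ) rfl (by omega) (by omega) hqR
    (neg_ne_zero.2 h.sign_ne) (by simpa using hφR)
    (fun y hy => by simpa using hφL y (hYL y hy)) (hgen'.mono hRY)
    (fun _ => ⟨p, hpY, fun x hx h1 h2 => by
      rw [orient_swap, neg_mul_neg]
      exact hqp x hx h1 h2⟩)
  have hQ₁ := hm.cons (a := b) (by rwa [hU]) (by simp [hbR, hbY]) (sees_of_bridge (a := p) (σ := σ)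
      (by rw [← orient_rotate]; exact hqbp)
      (fun x hx h1 h2 => hqp x hx h2 h1))
  rw [hU] at hQ₁
  have hQ := hQ₁.cons h.gen (fun ht => h.ext_t (subset_convexHull ℝ _ ht))
    (sees_of_bridge (a := q) (σ := -σ) (by
      have := h.orient_t_pos hbL hqR
      rw [orient_swap, neg_mul_neg, ← orient_rotate, ← orient_rotate]; exact this)
      (fun x hx h1 h2 => by rw [orient_swap, neg_mul_neg]; exact hbq' x hx h2 h1))
  -- the path from `s`
  obtain ⟨l₁, hl₁⟩ := h.exists_path hbL hb
  have hRt : ((insert t R : Finset Plane) : Set Plane) ⊆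
      insert t (insert s (L ∪ R : Set Plane)) := by
    intro x; simp only [Finset.coe_insert, Set.mem_insert_iff, Set.mem_union]; tauto
  have hbtR : b ∉ convexHull ℝ ((insert t R : Finset Plane) : Set Plane) :=
    fun hbt => Set.disjoint_left.1 (h.disjoint_hulls hRne)
      (subset_convexHull ℝ _ (by simp [hbL])) hbt
  obtain ⟨τ, hτ, a, haR, hat, hax⟩ := exists_tangent_ne
    (by rw [Finset.card_insert_of_notMem htR]; omega) hbtR
    (h.gen.mono (Set.insert_subset (by simp [hbL]) hRt)) t
  replace haR : a ∈ R := (Finset.mem_insert.1 haR).resolve_left hat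
  -- the line `b q` has `t` and the other points of `R` on different sides, so it is no tangent
  have haq : a ≠ q := by
    rintro rfl
    obtain ⟨y, hy, hya⟩ := Finset.exists_mem_ne (by omega : 1 < R.card) a
    have h1 := hax t (by simp) hat.symm
    have h2 := hax y (by simp [hy]) hya
    have h3 := h.orient_t_pos hbL hqR
    rw [← orient_rotate] at h3
    have h4 := hbq y (Or.inr hy) (fun hyb => hbR (hyb ▸ hy)) hya
    linarith [mul_neg_of_pos_of_neg h1 h4, mul_pos h2 h3]
  obtain ⟨l₂, hl₂⟩ := exists_planePath (insert t R) a (by simp [haR])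
    (notMem_convexHull_of_forall_orient_pos hax) (h.gen.mono hRt)
  have hP := hl₁.append hl₂ (by rw [union_eq]; exact h.gen) (h.disjoint_hulls hRne)
    (sees_of_forall_orient_pos hax) (h.sees_neg_side hb (h.orient_s_neg hbL haR))
  rw [union_eq] at hP
  have hPe : ∀ x y, s(x, y) ∈ pathEdges (s :: l₁ ++ [b] ++ a :: l₂) →
      (x ∈ insert s L ∧ y ∈ insert s L) ∨ s(x, y) = s(b, a) ∨ x ∈ insert t R ∧ y ∈ insert t R := by
    intro x y h
    rw [pathEdges_append, List.mem_append, List.mem_cons] at h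
    exact h.imp hl₁.edge_mem (Or.imp_right hl₂.edge_mem)
  have hYs : ∀ y ∈ Y, y = s ∨ y ∈ L := fun y hy => Finset.mem_insert.1 (hYL y hy)
  simp only [Finset.mem_insert] at hPe
  refine ⟨_, _, hP, hQ, ?_, fun _ => ⟨fun hmem => ?_, fun hmem => ?_⟩⟩
  · intro e he hf
    rw [pathEdges, pathEdges, List.mem_cons, List.mem_cons] at hf
    rcases hf with rfl | rfl | hf
    · rcases hPe _ _ he with ⟨h1 | h1, -⟩ | h1 | ⟨-, h1 | h1⟩
      · exact hst h1.symm
      · exact htL h1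
      · rcases Sym2.eq_iff.1 h1 with ⟨h1, _⟩ | ⟨h1, _⟩
        · exact htL (h1 ▸ hbL)
        · exact hat h1.symm
      · exact htL (h1 ▸ hbL)
      · exact hbR h1
    · rcases hPe _ _ he with ⟨-, h1 | h1⟩ | h1 | ⟨h1 | h1, -⟩
      · exact hsR (h1 ▸ hqR)
      · exact hdis _ h1 hqR
      · rcases Sym2.eq_iff.1 h1 with ⟨_, h1⟩ | ⟨h1, _⟩
        · exact haq h1.symm
        · exact hbR (h1 ▸ haR)
      · exact htL (h1 ▸ hbL)
      · exact hbR h1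
    · obtain ⟨x, hx, y, hy, rfl⟩ := hme e hf
      rcases hPe _ _ he with ⟨h1 | h1, -⟩ | h1 | ⟨-, h1 | h1⟩
      · exact hsR (h1 ▸ hx)
      · exact hdis _ h1 hx
      · rcases Sym2.eq_iff.1 h1 with ⟨h1, _⟩ | ⟨_, h1⟩
        · exact hbR (h1 ▸ hx)
        · exact hbY (h1 ▸ hy)
      · rcases hYs y hy with h2 | h2
        · exact hst (h2.symm.trans h1)
        · exact htL (h1 ▸ h2)
      · rcases hYs y hy with h2 | h2
        · exact hsR (h2 ▸ h1)
        · exact hdis y h2 h1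
  · rcases hPe _ _ hmem with ⟨-, h1 | h1⟩ | h1 | ⟨h1 | h1, -⟩
    · exact hst h1.symm
    · exact htL h1
    · rcases Sym2.eq_iff.1 h1 with ⟨h1, _⟩ | ⟨h1, _⟩
      · exact hbs h1.symm
      · exact hsR (h1 ▸ haR)
    · exact hst h1
    · exact hsR h1
  · rw [Sym2.eq_swap] at hmem
    exact hbs (eq_of_mem_pathEdges_cons hQ.nodup hmem).symm

theorem hasDisjointPaths (h : DiagonalSplit L R s t σ) (hLR : L.card = R.card)
    (hL2 : 2 ≤ L.card) : HasDisjointPaths (insert t (insert s (L ∪ R : Set Plane))) s t := by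
  have hLne : L.Nonempty := Finset.card_pos.1 (by omega)
  have hRne : R.Nonempty := Finset.card_pos.1 (by omega)
  have hgs : InGeneralPosition (insert s (L ∪ R : Set Plane)) :=
    h.gen.mono (Set.subset_insert _ _)
  have hLs : (L : Set Plane) ⊆ L ∪ R := Set.subset_union_left
  have hRs : (R : Set Plane) ⊆ L ∪ R := Set.subset_union_right
  have hes : s ∉ convexHull ℝ (L ∪ R : Set Plane) :=
    notMem_convexHull_mono h.ext_s (Set.subset_insert _ _)
  obtain ⟨φ, hφt, hφL, hφR⟩ := h.exists_line hRne
  obtain ⟨b, hb, q, hq, hbq⟩ := exists_bridge hLne hRne (hgs.mono (Set.subset_insert _ _)) φ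
    (fun a ha => hφL a (Finset.mem_insert_of_mem ha)) hφR h.sign_ne
  obtain ⟨c, hc, hcx⟩ := exists_tangent hLne (notMem_convexHull_mono hes hLs)
    (hgs.mono (Set.insert_subset_insert hLs)) h.sign_ne
  obtain ⟨d, hd, hdx⟩ := exists_tangent hRne (notMem_convexHull_mono hes hRs)
    (hgs.mono (Set.insert_subset_insert hRs)) h.symm.sign_ne
  by_cases hbc : b = c
  · by_cases hqd : q = d
    · subst hbc hqd
      exact h.hasDisjointPaths_of_eq hLR hL2 hb hq hbq hcx
        (fun x hx hxq => by have := hdx x hx hxq; linarith)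
    · rw [Set.union_comm]
      refine h.symm.hasDisjointPaths_of_ne hLR.symm hq hb (fun x hx h1 h2 => ?_) hd hdx hqd
      rw [orient_swap, neg_mul_neg]
      exact hbq x (by rwa [Set.union_comm]) h2 h1
  · exact h.hasDisjointPaths_of_ne hLR hb hq hbq hc hcx hbc

end DiagonalSplit

/-! ### The general case -/

/-- The line through two points of `S` partitions the other points by their side. -/
theorem eq_insert_filter_orient_and_card {S : Finset Plane}
    (hgen : InGeneralPosition (S : Set Plane))
    {s t : Plane} (hs : s ∈ S) (ht : t ∈ S) (hst : s ≠ t) {σ : ℝ} (hσ : σ ≠ 0) :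
    S = insert t (insert s
      (S.filter (fun x => σ * orient t s x < 0) ∪ S.filter (fun x => 0 < σ * orient t s x))) ∧
    (S.filter (fun x => σ * orient t s x < 0)).card +
      (S.filter (fun x => 0 < σ * orient t s x)).card + 2 = S.card := by
  have hS : S = insert t (insert s
      (S.filter (fun x => σ * orient t s x < 0) ∪ S.filter (fun x => 0 < σ * orient t s x))) := by
    ext x
    simp only [Finset.mem_insert, Finset.mem_union, Finset.mem_filter]
    constructor
    · intro hx
      by_cases hxt : x = t
      · exact Or.inl hxt
      by_cases hxs : x = s
      · exact Or.inr (Or.inl hxs)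
      have h0 : σ * orient t s x ≠ 0 := mul_ne_zero hσ
        (hgen.orient_ne_zero ht hs hx hst.symm (Ne.symm hxt) (Ne.symm hxs))
      rcases lt_or_gt_of_ne h0 with h | h
      · exact Or.inr (Or.inr (Or.inl ⟨hx, h⟩))
      · exact Or.inr (Or.inr (Or.inr ⟨hx, h⟩))
    · rintro (rfl | rfl | h | h)
      · exact ht
      · exact hs
      · exact h.1
      · exact h.1
  refine ⟨hS, ?_⟩
  conv_rhs => rw [hS]
  rw [Finset.card_insert_of_notMem, Finset.card_insert_of_notMem, Finset.card_union_of_disjoint]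
  · rw [Finset.disjoint_filter]
    intro x _ h1 h2
    linarith
  · simp [orient_self_right]
  · simp [orient_self_left, hst.symm]

/-- If the line through `t` and `s` has fewer points on one side than on the other, then `s` is
in the smaller half for a suitable line through `t` that halves the other points. -/
theorem hasDisjointPaths_of_card_lt {S : Finset Plane} (hcard : 5 ≤ S.card)
    (hgen : InGeneralPosition (S : Set Plane)) {s t : Plane} (hs : s ∈ S) (ht : t ∈ S)
    (hst : s ≠ t) (hes : s ∉ convexHull ℝ (S \ {s} : Set Plane))
    (het : t ∉ convexHull ℝ (S \ {t} : Set Plane)) {σ : ℝ} (hσ : σ ≠ 0)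
    (hlt : (S.filter (fun x => σ * orient t s x < 0)).card <
      (S.filter (fun x => 0 < σ * orient t s x)).card) :
    HasDisjointPaths (S : Set Plane) s t := by
  have hc := (eq_insert_filter_orient_and_card hgen hs ht hst hσ).2
  have hS : insert t ((S.erase t : Finset Plane) : Set Plane) = S := by
    rw [← Finset.coe_insert, Finset.insert_erase ht]
  have hce := Finset.card_erase_of_mem ht
  rw [← Finset.coe_erase] at het
  obtain ⟨L, hLS, hLc, hL⟩ := exists_radial_split het (by rwa [hS]) hσ ((S.card - 1) / 2)
    (by omega)
  have hRc := Finset.card_sdiff_of_subset hLS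
  have hU : (L ∪ (S.erase t \ L : Finset Plane) : Set Plane) = (S.erase t : Finset Plane) := by
    rw [← Finset.coe_union, Finset.union_sdiff_of_subset hLS]
  have hsL : s ∈ L := by
    by_contra hsL
    have hsub : L ⊆ S.filter (fun x => σ * orient t s x < 0) := by
      intro l hl
      have := hL l hl s (by simp [hst, hs, hsL])
      rw [orient_swap_right] at this
      exact Finset.mem_filter.2 ⟨Finset.mem_of_mem_erase (hLS hl), by linarith⟩
    have := Finset.card_le_card hsub
    omega
  have := hasDisjointPaths_of_halving (L := L) (R := S.erase t \ L) (s := s) (t := t) hσ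
    (by rwa [hU, hS]) (by rwa [hU]) (by rwa [hU, hS]) hL (by omega) (by omega) (by omega) hsL
  rwa [hU, hS] at this

theorem hasDisjointPaths_of_ne {S : Finset Plane} (hcard : 5 ≤ S.card)
    (hgen : InGeneralPosition (S : Set Plane)) {s t : Plane} (hs : s ∈ S) (ht : t ∈ S)
    (hst : s ≠ t) (hes : s ∉ convexHull ℝ (S \ {s} : Set Plane))
    (het : t ∉ convexHull ℝ (S \ {t} : Set Plane)) : HasDisjointPaths (S : Set Plane) s t := by
  rcases lt_trichotomy (S.filter (fun x => 1 * orient t s x < 0)).card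
    (S.filter (fun x => 0 < 1 * orient t s x)).card with h | h | h
  · exact hasDisjointPaths_of_card_lt hcard hgen hs ht hst hes het one_ne_zero h
  · obtain ⟨hS, hc⟩ := eq_insert_filter_orient_and_card hgen hs ht hst one_ne_zero
    have hSc : (S : Set Plane) = insert t (insert s
        ((S.filter (fun x => 1 * orient t s x < 0) : Finset Plane) ∪
          (S.filter (fun x => 0 < 1 * orient t s x) : Finset Plane) : Set Plane)) := by
      rw [← Finset.coe_union, ← Finset.coe_insert, ← Finset.coe_insert, ← hS]
    rw [hSc]
    refine DiagonalSplit.hasDisjointPaths (σ := 1) ⟨one_ne_zero, by rwa [← hSc], ?_, ?_,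
      fun l hl => (Finset.mem_filter.1 hl).2, fun r hr => (Finset.mem_filter.1 hr).2⟩ h (by omega)
    · refine notMem_convexHull_mono het ?_
      rintro x (rfl | hx | hx)
      · exact ⟨hs, hst⟩
      · have := Finset.mem_filter.1 hx
        refine ⟨this.1, ?_⟩
        rintro rfl
        simp [orient_self_left] at this
      · have := Finset.mem_filter.1 hx
        refine ⟨this.1, ?_⟩
        rintro rfl
        simp [orient_self_left] at this
    · refine notMem_convexHull_mono hes ?_
      rintro x (rfl | hx | hx)
      · exact ⟨ht, hst.symm⟩
      · have := Finset.mem_filter.1 hx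
        refine ⟨this.1, ?_⟩
        rintro rfl
        simp [orient_self_right] at this
      · have := Finset.mem_filter.1 hx
        refine ⟨this.1, ?_⟩
        rintro rfl
        simp [orient_self_right] at this
  · refine hasDisjointPaths_of_card_lt hcard hgen hs ht hst hes het
      (neg_ne_zero.2 (one_ne_zero (α := ℝ))) ?_
    simpa using h

/-- Five points and a common starting point `s`. Let `p` and `c` be such that the line `p c`
separates `s` from the last two points `x` and `y`, where `x` is further from `c` as seen from `p`.
The paths are `s p x c y` and `s c p y x`. -/
theorem hasDisjointPaths_self_of_card_eq {S : Finset Plane} (hcard : S.card = 5)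
    (hgen : InGeneralPosition (S : Set Plane)) {s : Plane} (hs : s ∈ S)
    (hes : s ∉ convexHull ℝ (S \ {s} : Set Plane)) : HasDisjointPaths (S : Set Plane) s s := by
  have hS : insert s ((S.erase s : Finset Plane) : Set Plane) = S := by
    rw [← Finset.coe_insert, Finset.insert_erase hs]
  have hc4 : (S.erase s).card = 4 := by rw [Finset.card_erase_of_mem hs, hcard]
  rw [← Finset.coe_erase] at hes
  obtain ⟨p, hp, hpx⟩ := exists_tangent (Finset.card_pos.1 (by omega)) hes (by rwa [hS])
    one_ne_zero
  have hext := notMem_convexHull_of_forall_orient_pos hpx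
  rw [← Finset.coe_erase] at hext
  set T := (S.erase s).erase p with hT
  have hc3 : T.card = 3 := by rw [hT, Finset.card_erase_of_mem hp, hc4]
  have hTp : insert p (T : Set Plane) = (S.erase s : Finset Plane) := by
    rw [hT, ← Finset.coe_insert, Finset.insert_erase hp]
  have hgp : InGeneralPosition (insert p (T : Set Plane)) := by
    rw [hTp]; exact hgen.mono (by simp)
  obtain ⟨c, hcT, hcx⟩ := exists_tangent (Finset.card_pos.1 (by omega)) hext hgp
    (neg_ne_zero.2 one_ne_zero)
  obtain ⟨x, hxT, hxx⟩ := exists_tangent (Finset.card_pos.1 (by omega)) hext hgp one_ne_zero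
  have hcx' : c ≠ x := by
    rintro rfl
    obtain ⟨y, hy, hyc⟩ := Finset.exists_mem_ne (by omega : 1 < T.card) c
    have h1 := hcx y hy hyc
    have h2 := hxx y hy hyc
    linarith
  obtain ⟨y, hy⟩ := Finset.card_eq_one.1 (show ((T.erase c).erase x).card = 1 by
    rw [Finset.card_erase_of_mem (Finset.mem_erase.2 ⟨hcx'.symm, hxT⟩),
      Finset.card_erase_of_mem hcT, hc3])
  have hyT' : y ∈ (T.erase c).erase x := by rw [hy]; simp
  obtain ⟨hyx, hyc, hyT⟩ : y ≠ x ∧ y ≠ c ∧ y ∈ T := by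
    simpa only [Finset.mem_erase] using hyT'
  have hTe : (T : Set Plane) = {c, x, y} := by
    have : T = {c, x, y} := by
      rw [← hy, Finset.insert_erase (Finset.mem_erase.2 ⟨hcx'.symm, hxT⟩),
        Finset.insert_erase hcT]
    rw [this]; simp
  have hSe : (S : Set Plane) = {s, p, c, x, y} := by rw [← hS, ← hTp, hTe]
  have hpT : p ∉ T := by simp [hT]
  have hsT : s ∉ T := by simp [hT]
  have hsp : s ≠ p := by rintro rfl; simp at hp
  have hsc : s ≠ c := by rintro rfl; exact hsT hcT
  have hsx : s ≠ x := by rintro rfl; exact hsT hxT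
  have hsy : s ≠ y := by rintro rfl; exact hsT hyT
  have hpc : p ≠ c := by rintro rfl; exact hpT hcT
  have hpx' : p ≠ x := by rintro rfl; exact hpT hxT
  have hpy : p ≠ y := by rintro rfl; exact hpT hyT
  have hpcs : 0 < 1 * orient p c s := by
    rw [← orient_rotate, ← orient_rotate]
    exact hpx c (Finset.mem_of_mem_erase hcT) hpc.symm
  have hpcx : 1 * orient p c x < 0 := by have := hcx x hxT hcx'.symm; linarith
  have hpcy : 1 * orient p c y < 0 := by have := hcx y hyT hyc; linarith
  have hbr : ∀ z ∈ insert p (T : Set Plane), z ≠ p → z ≠ c → 1 * orient p c z < 0 := by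
    rw [hTe]
    rintro z (rfl | rfl | rfl | rfl) h1 h2
    · exact absurd rfl h1
    · exact absurd rfl h2
    · exact hpcx
    · exact hpcy
  rw [hSe] at hgen ⊢
  rw [hTe] at hbr
  have hne : ∀ {a b d : Plane}, a ∈ ({s, p, c, x, y} : Set Plane) →
      b ∈ ({s, p, c, x, y} : Set Plane) → d ∈ ({s, p, c, x, y} : Set Plane) → a ≠ b → a ≠ d →
      b ≠ d → orient a b d ≠ 0 := fun ha hb hd => hgen.orient_ne_zero ha hb hd
  -- in a triangle every vertex sees the two others
  have htri : ∀ {a b d : Plane}, orient a b d ≠ 0 → Sees a b {b, d} := by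
    intro a b d h
    refine sees_of_forall_orient_pos (σ := orient a b d) ?_
    rintro z (rfl | rfl) hz
    · exact absurd rfl hz
    · exact mul_self_pos.2 h
  have hcy : IsPlanePath {c, y} [c, y] := (isPlanePath_singleton y).cons
    (hgen.mono (by intro z; simp; tauto)) (by simpa using hyc.symm) (sees_singleton c y)
  have hxcy : IsPlanePath {x, c, y} [x, c, y] := hcy.cons
    (hgen.mono (by intro z; simp; tauto)) (by simp [hcx'.symm, hyx.symm])
    (htri (hne (by simp) (by simp) (by simp) hcx'.symm hyx.symm hyc.symm))
  have hpxcy : IsPlanePath {p, x, c, y} [p, x, c, y] := hxcy.cons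
    (hgen.mono (by intro z; simp; tauto)) (by simp [hpx', hpc, hpy])
    (sees_of_forall_orient_pos (σ := 1) (by
      intro z hz hzx
      refine hxx z ?_ hzx
      rw [← Finset.mem_coe, hTe]
      revert hz; simp; tauto))
  have hset : ({p, x, c, y} : Set Plane) = {p, c, x, y} := by
    rw [Set.insert_comm x c]
  rw [hset] at hpxcy
  have hP := hpxcy.cons hgen (by simp [hsp, hsc, hsx, hsy])
    (sees_of_bridge (a := c) (b := p) (σ := -1) (by rw [orient_swap]; linarith)
      (fun z hz h1 h2 => by have := hbr z hz h2 h1; rw [orient_swap]; linarith))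
  have hyx : IsPlanePath {y, x} [y, x] := (isPlanePath_singleton x).cons
    (hgen.mono (by intro z; simp; tauto)) (by simpa using hyx) (sees_singleton y x)
  have hpyx : IsPlanePath {p, y, x} [p, y, x] := hyx.cons
    (hgen.mono (by intro z; simp; tauto)) (by simp [hpx', hpy])
    (htri (hne (by simp) (by simp) (by simp) hpy hpx' (by tauto)))
  have hset : ({p, y, x} : Set Plane) = {p, x, y} := by rw [Set.pair_comm y x]
  rw [hset] at hpyx
  have hcpyx : IsPlanePath (insert c {p, x, y}) [c, p, y, x] := hpyx.cons
    (hgen.mono (by intro z; simp; tauto)) (by simp [hpc.symm, hcx', hyc.symm])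
    (sees_of_forall_orient_pos (σ := 1) (by
      rintro z (rfl | rfl | rfl) hz
      · exact absurd rfl hz
      · rw [orient_swap]; linarith
      · rw [orient_swap]; linarith))
  rw [Set.insert_comm c p] at hcpyx
  have hQ := hcpyx.cons hgen (by simp [hsp, hsc, hsx, hsy]) (sees_of_bridge hpcs hbr)
  refine ⟨_, _, hP, hQ, ?_, fun h => absurd rfl h⟩
  intro e h1 h2
  simp only [pathEdges, List.mem_cons, List.not_mem_nil, or_false] at h1 h2
  rcases h1 with rfl | rfl | rfl | rfl <;> simp at h2 <;> grind

theorem hasDisjointPaths_self {S : Finset Plane} (hcard : 5 ≤ S.card)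
    (hgen : InGeneralPosition (S : Set Plane)) {s : Plane} (hs : s ∈ S)
    (hes : s ∉ convexHull ℝ (S \ {s} : Set Plane)) : HasDisjointPaths (S : Set Plane) s s := by
  rcases Nat.eq_or_lt_of_le hcard with h5 | h6
  · exact hasDisjointPaths_self_of_card_eq h5.symm hgen hs hes
  have hS : insert s ((S.erase s : Finset Plane) : Set Plane) = S := by
    rw [← Finset.coe_insert, Finset.insert_erase hs]
  have hc := Finset.card_erase_of_mem hs
  rw [← Finset.coe_erase] at hes
  have hgs : InGeneralPosition (insert s ((S.erase s : Finset Plane) : Set Plane)) := by rwa [hS]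
  obtain ⟨p, hp, hpx⟩ := exists_tangent (Finset.card_pos.1 (by omega)) hes hgs one_ne_zero
  obtain ⟨τ, hτ, q, hq, hqp, hqx⟩ := exists_tangent_ne (by omega) hes hgs p
  obtain ⟨l, m, hl, hm, hlm, -⟩ := hasDisjointPaths_of_ne (by omega)
    (hgs.mono (Set.subset_insert _ _)) hp hq hqp.symm
    (notMem_convexHull_of_forall_orient_pos hpx) (notMem_convexHull_of_forall_orient_pos hqx)
  have hse : s ∉ ((S.erase s : Finset Plane) : Set Plane) := by simp
  have hP := hl.cons hgs hse (sees_of_forall_orient_pos hpx)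
  have hQ := hm.cons hgs hse (sees_of_forall_orient_pos hqx)
  rw [hS] at hP hQ
  refine ⟨_, _, hP, hQ, ?_, fun h => absurd rfl h⟩
  intro e h1 h2
  rw [pathEdges, List.mem_cons] at h1 h2
  rcases h1 with rfl | h1 <;> rcases h2 with h2 | h2
  · exact hqp ((Sym2.congr_right.1 h2).symm)
  · exact hse (hm.edge_mem h2).1
  · subst h2
    exact hse (hl.edge_mem h1).1
  · exact hlm h1 h2

end

theorem theorem2 (S : Finset Plane) (hcard : 5 ≤ S.card)
    (hgen : InGeneralPosition (S : Set Plane)) (s t : Plane) (hs : s ∈ S) (ht : t ∈ S)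
    (hsb : s ∈ frontier (convexHull ℝ (S : Set Plane)))
    (htb : t ∈ frontier (convexHull ℝ (S : Set Plane))) :
    ∃ (u v : Plane) (P : GeometricWalk s u) (Q : GeometricWalk t v),
      IsPlaneSpanningPath (S : Set Plane) P ∧ IsPlaneSpanningPath (S : Set Plane) Q ∧
      List.Disjoint P.edges Q.edges ∧
      (s ≠ t → s(s, t) ∉ P.edges ∧ s(s, t) ∉ Q.edges) := by
  have hes := notMem_convexHull_of_mem_frontier hgen hs hsb
  have het := notMem_convexHull_of_mem_frontier hgen ht htb
  have h : HasDisjointPaths (S : Set Plane) s t := by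
    rcases eq_or_ne s t with rfl | hst
    · exact hasDisjointPaths_self hcard hgen hs hes
    · exact hasDisjointPaths_of_ne hcard hgen hs ht hst hes het
  obtain ⟨l, m, hl, hm, hlm, hst⟩ := h
  obtain ⟨u, P, hP, hPe⟩ := hl.exists_walk
  obtain ⟨v, Q, hQ, hQe⟩ := hm.exists_walk
  refine ⟨u, v, P, Q, hP, hQ, ?_, ?_⟩
  · rwa [hPe, hQe]
  · rwa [hPe, hQe]
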